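/- Let $M$ be a non-empty smooth manifold of dimension $2n+1\ge 5$ carrying a paracontact metric structure $(\varphi,\xi,\eta,g)$. This means: $\varphi$ is a smooth $(1,1)$-tensor field, $\xi$ a smooth vector field, $\eta$ a smooth $1$-form and $g$ a smooth pseudo-Riemannian metric on $M$ such that $$\varphi\xi=0,\qquad \eta\circ\varphi=0,\qquad \eta(\xi)=1,\qquad \varphi^2=\mathrm{id}-\eta\otimes\xi,$$ the eigenspaces of $\varphi|_{\ker\eta}$ for the eigenvalues $1$ and $-1$ both have dimension $n$ at every point, $$g(\varphi X,\varphi Y)=-g(X,Y)+\eta(X)\eta(Y),\qquad g(X,\varphi Y)=d\eta(X,Y),$$ where $d\eta(X,Y)=\tfrac12\bigl(X\eta(Y)-Y\eta(X)-\eta([X,Y])\bigr)$. Let $h=\tfrac12\mathcal L_\xi\varphi$ and $|h|^2=g^{ir}g^{js}h_{ij}h_{rs}$, where $h_{ij}=g_{jr}h^r_i$. Suppose that $g$ has constant sectional curvature $c\in\mathbb R$: with $R(X,Y)Z=\nabla_X\nabla_YZ-\nabla_Y\nabla_XZ-\nabla_{[X,Y]}Z$ for the Levi-Civita connection $\nabla$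 of $g$, one has $$\frac{g(R(X,Y)Y,X)}{g(X,X)g(Y,Y)-g(X,Y)^2}=c$$ for all tangent vectors $X,Y$ at a common point for which the denominator is non-zero. Then $c=-1$, and $|h|^2=0$ at every point of $M$. -/

import Mathlib

open Bundle VectorField FiberBundle
open scoped Manifold ContDiff

noncomputable section

namespace Paracontact

section Metric

/-- A smooth pseudo-Riemannian metric on `M`: a smooth field of symmetric nondegenerate bilinear
forms on the tangent spaces (of arbitrary signature). -/
structure PseudoRiemannianMetric (E : Type*) [NormedAddCommGroup E] [NormedSpace ℝ E]
    (M : Type*) [TopologicalSpace M] [ChartedSpace E M] [IsManifold 𝓘(ℝ, E) ∞ M] where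
  /-- The bilinear form on each tangent space. -/
  val (x : M) : TangentSpace 𝓘(ℝ, E) x →L[ℝ] TangentSpace 𝓘(ℝ, E) x →L[ℝ] ℝ
  symm (x : M) (v w : TangentSpace 𝓘(ℝ, E) x) : val x v w = val x w v
  nondegenerate (x : M) (v : TangentSpace 𝓘(ℝ, E) x) (hv : ∀ w, val x v w = 0) : v = 0
  contMDiff : ContMDiff 𝓘(ℝ, E) (𝓘(ℝ, E).prod 𝓘(ℝ, E →L[ℝ] E →L[ℝ] ℝ)) ∞
    (fun x ↦ TotalSpace.mk' (E →L[ℝ] E →L[ℝ] ℝ)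
      (E := fun x : M ↦ TangentSpace 𝓘(ℝ, E) x →L[ℝ] TangentSpace 𝓘(ℝ, E) x →L[ℝ] ℝ) x (val x))

variable {E : Type*} [NormedAddCommGroup E] [NormedSpace ℝ E]
  {M : Type*} [TopologicalSpace M] [ChartedSpace E M] [IsManifold 𝓘(ℝ, E) ∞ M]

/-- The function `g(X, Y)`. -/
def PseudoRiemannianMetric.inner (g : PseudoRiemannianMetric E M)
    (X Y : Π x : M, TangentSpace 𝓘(ℝ, E) x) (x : M) : ℝ :=
  g.val x (X x) (Y x)

/-- Half of the right-hand side of the Koszul formula, that is, `g(∇_X Y, Z)`. -/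
def PseudoRiemannianMetric.koszul (g : PseudoRiemannianMetric E M)
    (X Y Z : Π x : M, TangentSpace 𝓘(ℝ, E) x) (x : M) : ℝ :=
  (1 / 2 : ℝ) *
    (mvfderiv 𝓘(ℝ, E) (g.inner Y Z) x (X x)
      + mvfderiv 𝓘(ℝ, E) (g.inner Z X) x (Y x)
      - mvfderiv 𝓘(ℝ, E) (g.inner X Y) x (Z x)
      + g.inner (mlieBracket 𝓘(ℝ, E) X Y) Z x
      + g.inner (mlieBracket 𝓘(ℝ, E) Z X) Y x
      - g.inner (mlieBracket 𝓘(ℝ, E) Y Z) X x)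

theorem PseudoRiemannianMetric.inner_apply (g : PseudoRiemannianMetric E M)
    (X Y : Π x : M, TangentSpace 𝓘(ℝ, E) x) (x : M) : g.inner X Y x = g.val x (X x) (Y x) :=
  rfl

theorem PseudoRiemannianMetric.mdifferentiableAt_inner (g : PseudoRiemannianMetric E M)
    {X Y : Π x : M, TangentSpace 𝓘(ℝ, E) x} {x : M}
    (hX : MDiffAt (T% X) x) (hY : MDiffAt (T% Y) x) :
    MDifferentiableAt 𝓘(ℝ, E) 𝓘(ℝ) (g.inner X Y) x := by
  have h : MDifferentiableAt 𝓘(ℝ, E) (𝓘(ℝ, E).prod 𝓘(ℝ))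
      (fun m ↦ TotalSpace.mk' ℝ (E := Bundle.Trivial M ℝ) m (g.val m (X m) (Y m))) x := by
    apply MDifferentiableAt.clm_bundle_apply₂ (F₁ := E) (F₂ := E)
    · exact g.contMDiff.mdifferentiableAt (by simp)
    · exact hX
    · exact hY
  simp only [mdifferentiableAt_totalSpace] at h
  exact h.2

theorem PseudoRiemannianMetric.inner_symm (g : PseudoRiemannianMetric E M)
    (X Y : Π x : M, TangentSpace 𝓘(ℝ, E) x) : g.inner X Y = g.inner Y X := by
  funext x
  exact g.symm x _ _

theorem PseudoRiemannianMetric.inner_smul_left (g : PseudoRiemannianMetric E M) (f : M → ℝ)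
    (X Y : Π x : M, TangentSpace 𝓘(ℝ, E) x) : g.inner (f • X) Y = f * g.inner X Y := by
  funext x
  simp [inner_apply]

theorem PseudoRiemannianMetric.inner_smul_right (g : PseudoRiemannianMetric E M) (f : M → ℝ)
    (X Y : Π x : M, TangentSpace 𝓘(ℝ, E) x) : g.inner X (f • Y) = f * g.inner X Y := by
  funext x
  simp [inner_apply]

theorem PseudoRiemannianMetric.inner_add_left (g : PseudoRiemannianMetric E M)
    (X X' Y : Π x : M, TangentSpace 𝓘(ℝ, E) x) :
    g.inner (X + X') Y = g.inner X Y + g.inner X' Y := by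
  funext x
  simp [inner_apply]

theorem PseudoRiemannianMetric.inner_add_right (g : PseudoRiemannianMetric E M)
    (X Y Y' : Π x : M, TangentSpace 𝓘(ℝ, E) x) :
    g.inner X (Y + Y') = g.inner X Y + g.inner X Y' := by
  funext x
  simp [inner_apply]

theorem PseudoRiemannianMetric.eq_of_forall_val (g : PseudoRiemannianMetric E M) {x : M}
    {v v' : TangentSpace 𝓘(ℝ, E) x} (h : ∀ w, g.val x v w = g.val x v' w) : v = v' := by
  rw [← sub_eq_zero]
  refine g.nondegenerate x _ fun w ↦ ?_
  simp [h w]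

variable [FiniteDimensional ℝ E]

instance (x : M) : FiniteDimensional ℝ (TangentSpace 𝓘(ℝ, E) x) :=
  inferInstanceAs (FiniteDimensional ℝ E)

instance (x : M) : T2Space (TangentSpace 𝓘(ℝ, E) x) :=
  inferInstanceAs (T2Space E)

/-- The Koszul expression is tensorial in `X`. -/
theorem PseudoRiemannianMetric.koszul_tensorial_left (g : PseudoRiemannianMetric E M)
    {Y Z : Π x : M, TangentSpace 𝓘(ℝ, E) x} {x : M}
    (hY : MDiffAt (T% Y) x) (hZ : MDiffAt (T% Z) x) :
    TensorialAt 𝓘(ℝ, E) E (fun X ↦ g.koszul X Y Z x) x where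
  smul {f X} hf hX := by
    have hXY := g.mdifferentiableAt_inner hX hY
    have hZX := g.mdifferentiableAt_inner hZ hX
    simp only [koszul, inner_smul_left, inner_smul_right, mvfderiv_mul hf hXY,
      mvfderiv_mul hf hZX]
    simp only [inner_apply, mlieBracket_smul_left hf hX, mlieBracket_smul_right hf hX]
    simp [inner_apply, g.symm x (Z x) (X x)]
    ring
  add {X X'} hX hX' := by
    simp only [koszul, inner_add_left, inner_add_right,
      mvfderiv_add (g.mdifferentiableAt_inner hX hY) (g.mdifferentiableAt_inner hX' hY),
      mvfderiv_add (g.mdifferentiableAt_inner hZ hX) (g.mdifferentiableAt_inner hZ hX')]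
    simp only [inner_apply, mlieBracket_add_left hX hX', mlieBracket_add_right hX hX']
    simp [inner_apply]
    ring

/-- The Koszul expression is tensorial in `Z`. -/
theorem PseudoRiemannianMetric.koszul_tensorial_right (g : PseudoRiemannianMetric E M)
    {X Y : Π x : M, TangentSpace 𝓘(ℝ, E) x} {x : M}
    (hX : MDiffAt (T% X) x) (hY : MDiffAt (T% Y) x) :
    TensorialAt 𝓘(ℝ, E) E (fun Z ↦ g.koszul X Y Z x) x where
  smul {f Z} hf hZ := by
    have hYZ := g.mdifferentiableAt_inner hY hZ
    have hZX := g.mdifferentiableAt_inner hZ hX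
    simp only [koszul, inner_smul_left, inner_smul_right, mvfderiv_mul hf hYZ,
      mvfderiv_mul hf hZX]
    simp only [inner_apply, mlieBracket_smul_left hf hZ, mlieBracket_smul_right hf hZ]
    simp [inner_apply, g.symm x (Z x) (X x), g.symm x (Z x) (Y x)]
    ring
  add {Z Z'} hZ hZ' := by
    simp only [koszul, inner_add_left, inner_add_right,
      mvfderiv_add (g.mdifferentiableAt_inner hY hZ) (g.mdifferentiableAt_inner hY hZ'),
      mvfderiv_add (g.mdifferentiableAt_inner hZ hX) (g.mdifferentiableAt_inner hZ' hX)]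
    simp only [inner_apply, mlieBracket_add_left hZ hZ', mlieBracket_add_right hZ hZ']
    simp [inner_apply]
    ring

/-- The bilinear form `(v, z) ↦ g(∇_v Y, z)` on the tangent space at `x`, for a vector field `Y`
that is differentiable at `x`. -/
def PseudoRiemannianMetric.koszulForm (g : PseudoRiemannianMetric E M)
    (Y : Π x : M, TangentSpace 𝓘(ℝ, E) x) (x : M) (hY : MDiffAt (T% Y) x) :
    TangentSpace 𝓘(ℝ, E) x →L[ℝ] TangentSpace 𝓘(ℝ, E) x →L[ℝ] ℝ :=
  TensorialAt.mkHom₂ (F := E) (F' := E) (fun X Z ↦ g.koszul X Y Z x) x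
    (fun _ hZ ↦ g.koszul_tensorial_left hY hZ)
    (fun _ hX ↦ g.koszul_tensorial_right hX hY)

theorem PseudoRiemannianMetric.koszulForm_apply (g : PseudoRiemannianMetric E M)
    {X Y Z : Π x : M, TangentSpace 𝓘(ℝ, E) x} {x : M}
    (hX : MDiffAt (T% X) x) (hY : MDiffAt (T% Y) x) (hZ : MDiffAt (T% Z) x) :
    g.koszulForm Y x hY (X x) (Z x) = g.koszul X Y Z x :=
  TensorialAt.mkHom₂_apply (F := E) (F' := E) (Φ := fun X Z ↦ g.koszul X Y Z x)
    (fun _ hZ ↦ g.koszul_tensorial_left hY hZ)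
    (fun _ hX ↦ g.koszul_tensorial_right hX hY) hX hZ

/-- The musical isomorphism `v ↦ g(v, ·)`. -/
def PseudoRiemannianMetric.flat (g : PseudoRiemannianMetric E M) (x : M) :
    TangentSpace 𝓘(ℝ, E) x ≃L[ℝ] (TangentSpace 𝓘(ℝ, E) x →L[ℝ] ℝ) :=
  (LinearEquiv.ofInjectiveOfFinrankEq (g.val x).toLinearMap
    (by
      rw [← LinearMap.ker_eq_bot, LinearMap.ker_eq_bot']
      intro v hv
      exact g.nondegenerate x v fun w ↦ congrArg (fun l ↦ l w) hv)
    (by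
      rw [← LinearEquiv.finrank_eq
        (LinearMap.toContinuousLinearMap (𝕜 := ℝ) (E := TangentSpace 𝓘(ℝ, E) x) (F' := ℝ))]
      exact (Subspace.dual_finrank_eq).symm)).toContinuousLinearEquiv

theorem PseudoRiemannianMetric.flat_symm_apply (g : PseudoRiemannianMetric E M) (x : M)
    (l : TangentSpace 𝓘(ℝ, E) x →L[ℝ] ℝ) (w : TangentSpace 𝓘(ℝ, E) x) :
    g.val x ((g.flat x).symm l) w = l w := by
  have h : ∀ v, g.flat x v = g.val x v := fun _ ↦ rfl
  rw [← h, (g.flat x).apply_symm_apply]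

open scoped Classical in
/-- The Levi-Civita connection of `g` as an operation on vector fields, given by the Koszul
formula; `g.leviCivitaFun Y x v` is `∇_v Y`. (The value is `0` if `Y` is not differentiable
at `x`.) -/
def PseudoRiemannianMetric.leviCivitaFun (g : PseudoRiemannianMetric E M)
    (Y : Π x : M, TangentSpace 𝓘(ℝ, E) x) (x : M) :
    TangentSpace 𝓘(ℝ, E) x →L[ℝ] TangentSpace 𝓘(ℝ, E) x :=
  if hY : MDiffAt (T% Y) x then
    ((g.flat x).symm : (TangentSpace 𝓘(ℝ, E) x →L[ℝ] ℝ) →L[ℝ] TangentSpace 𝓘(ℝ, E) x) ∘L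
      g.koszulForm Y x hY
  else 0

/-- The Koszul formula. -/
theorem PseudoRiemannianMetric.val_leviCivitaFun (g : PseudoRiemannianMetric E M)
    {X Y Z : Π x : M, TangentSpace 𝓘(ℝ, E) x} {x : M}
    (hX : MDiffAt (T% X) x) (hY : MDiffAt (T% Y) x) (hZ : MDiffAt (T% Z) x) :
    g.val x (g.leviCivitaFun Y x (X x)) (Z x) = g.koszul X Y Z x := by
  rw [leviCivitaFun, dif_pos hY, ← g.koszulForm_apply hX hY hZ]
  exact g.flat_symm_apply x _ _

/-- The Levi-Civita connection of a pseudo-Riemannian metric. -/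
def PseudoRiemannianMetric.leviCivita (g : PseudoRiemannianMetric E M) :
    CovariantDerivative 𝓘(ℝ, E) E (fun x : M ↦ TangentSpace 𝓘(ℝ, E) x) where
  toFun := g.leviCivitaFun
  isCovariantDerivativeOnUniv :=
    { add := by
        intro Y Y' x hY hY' _
        ext1 v
        refine g.eq_of_forall_val fun w ↦ ?_
        have hX := mdifferentiableAt_extend 𝓘(ℝ, E) E v
        have hZ := mdifferentiableAt_extend 𝓘(ℝ, E) E w
        have hYY' := mdifferentiableAt_add_section hY hY'
        have h0 := g.val_leviCivitaFun hX hYY' hZ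
        have h1 := g.val_leviCivitaFun hX hY hZ
        have h2 := g.val_leviCivitaFun hX hY' hZ
        simp only [extend_apply_self] at h0 h1 h2
        rw [h0, add_apply, map_add, add_apply, h1, h2]
        simp only [koszul, inner_add_left, inner_add_right,
          mvfderiv_add (g.mdifferentiableAt_inner hX hY) (g.mdifferentiableAt_inner hX hY'),
          mvfderiv_add (g.mdifferentiableAt_inner hY hZ) (g.mdifferentiableAt_inner hY' hZ)]
        simp only [inner_apply, mlieBracket_add_left hY hY', mlieBracket_add_right hY hY']
        simp [inner_apply]
        ring
      leibniz := by
        intro Y f x hY hf _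
        ext1 v
        refine g.eq_of_forall_val fun w ↦ ?_
        have hX := mdifferentiableAt_extend 𝓘(ℝ, E) E v
        have hZ := mdifferentiableAt_extend 𝓘(ℝ, E) E w
        have h0 := g.val_leviCivitaFun hX (hf.smul_section hY) hZ
        have h1 := g.val_leviCivitaFun hX hY hZ
        simp only [extend_apply_self] at h0 h1
        rw [h0, add_apply, map_add, add_apply,
          smul_apply, map_smul, smul_apply, h1]
        simp only [koszul, inner_smul_left, inner_smul_right,
          mvfderiv_mul hf (g.mdifferentiableAt_inner hX hY),
          mvfderiv_mul hf (g.mdifferentiableAt_inner hY hZ)]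
        simp only [inner_apply, mlieBracket_smul_left hf hY, mlieBracket_smul_right hf hY]
        simp [inner_apply, g.symm x v (Y x)]
        ring }

/-- The Levi-Civita connection is torsion-free. -/
theorem PseudoRiemannianMetric.leviCivita_torsion_free (g : PseudoRiemannianMetric E M)
    {X Y : Π x : M, TangentSpace 𝓘(ℝ, E) x} {x : M}
    (hX : MDiffAt (T% X) x) (hY : MDiffAt (T% Y) x) :
    g.leviCivita Y x (X x) - g.leviCivita X x (Y x) = mlieBracket 𝓘(ℝ, E) X Y x := by
  refine g.eq_of_forall_val fun w ↦ ?_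
  have hZ := mdifferentiableAt_extend 𝓘(ℝ, E) E w
  have h1 := g.val_leviCivitaFun hX hY hZ
  have h2 := g.val_leviCivitaFun hY hX hZ
  simp only [extend_apply_self] at h1 h2
  rw [map_sub, sub_apply]
  change g.val x (g.leviCivitaFun Y x (X x)) w - g.val x (g.leviCivitaFun X x (Y x)) w = _
  rw [h1, h2]
  simp only [koszul, g.inner_symm Y X, g.inner_symm (extend E w) X, g.inner_symm (extend E w) Y,
    mlieBracket_swap (V := Y) (W := X), mlieBracket_swap (V := extend E w) (W := X),
    mlieBracket_swap (V := extend E w) (W := Y)]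
  simp [inner_apply]
  ring

/-- The Levi-Civita connection is compatible with the metric. -/
theorem PseudoRiemannianMetric.leviCivita_metric (g : PseudoRiemannianMetric E M)
    {X Y Z : Π x : M, TangentSpace 𝓘(ℝ, E) x} {x : M}
    (hX : MDiffAt (T% X) x) (hY : MDiffAt (T% Y) x) (hZ : MDiffAt (T% Z) x) :
    mvfderiv 𝓘(ℝ, E) (g.inner Y Z) x (X x)
      = g.val x (g.leviCivita Y x (X x)) (Z x) + g.val x (Y x) (g.leviCivita Z x (X x)) := by
  have h1 := g.val_leviCivitaFun hX hY hZ
  have h2 := g.val_leviCivitaFun hX hZ hY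
  rw [g.symm x (Y x)]
  change _ = g.val x (g.leviCivitaFun Y x (X x)) (Z x) + g.val x (g.leviCivitaFun Z x (X x)) (Y x)
  rw [h1, h2]
  simp only [koszul, g.inner_symm Z Y, g.inner_symm Z X, g.inner_symm Y X,
    mlieBracket_swap (V := Z) (W := X), mlieBracket_swap (V := Z) (W := Y),
    mlieBracket_swap (V := Y) (W := X)]
  simp [inner_apply]
  ring

/-- The curvature `R(X, Y) Z = ∇_X ∇_Y Z - ∇_Y ∇_X Z - ∇_[X, Y] Z` of the Levi-Civita
connection. -/
def PseudoRiemannianMetric.curvature (g : PseudoRiemannianMetric E M)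
    (X Y Z : Π x : M, TangentSpace 𝓘(ℝ, E) x) (x : M) : TangentSpace 𝓘(ℝ, E) x :=
  g.leviCivita (fun y ↦ g.leviCivita Z y (Y y)) x (X x)
    - g.leviCivita (fun y ↦ g.leviCivita Z y (X y)) x (Y x)
    - g.leviCivita Z x (mlieBracket 𝓘(ℝ, E) X Y x)

/-- `g(X, X) g(Y, Y) - g(X, Y)²`; this is nonzero at `x` iff `X x` and `Y x` span a plane on which
`g` is nondegenerate. -/
def PseudoRiemannianMetric.areaSq (g : PseudoRiemannianMetric E M)
    (X Y : Π x : M, TangentSpace 𝓘(ℝ, E) x) (x : M) : ℝ :=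
  g.inner X X x * g.inner Y Y x - g.inner X Y x ^ 2

/-- The sectional curvature at `x` of the plane spanned by `X x` and `Y x`. -/
def PseudoRiemannianMetric.sectionalCurvature (g : PseudoRiemannianMetric E M)
    (X Y : Π x : M, TangentSpace 𝓘(ℝ, E) x) (x : M) : ℝ :=
  g.inner (g.curvature X Y Y) X x / g.areaSq X Y x

/-- `g` has constant sectional curvature `c`: the sectional curvature of every nondegenerate
tangent plane is `c`. The vector fields only serve to extend a basis of the plane smoothly
to a neighbourhood of the point. -/
def PseudoRiemannianMetric.HasConstantSectionalCurvature (g : PseudoRiemannianMetric E M)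
    (c : ℝ) : Prop :=
  ∀ (x : M) (X Y : Π x : M, TangentSpace 𝓘(ℝ, E) x),
    CMDiffAt ∞ (T% X) x → CMDiffAt ∞ (T% Y) x → g.areaSq X Y x ≠ 0 →
      g.sectionalCurvature X Y x = c

open scoped Matrix in
/-- The squared norm `|T|² = g^{ir} g^{js} T_{ij} T_{rs}`, with `T_{ij} = g_{jr} T^r_i`, of an
endomorphism `T` of the tangent space at `x`, computed in the basis `b`. -/
def PseudoRiemannianMetric.normSq (g : PseudoRiemannianMetric E M) (x : M)
    {ι : Type*} [Fintype ι] [DecidableEq ι] (b : Module.Basis ι ℝ (TangentSpace 𝓘(ℝ, E) x))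
    (T : TangentSpace 𝓘(ℝ, E) x →L[ℝ] TangentSpace 𝓘(ℝ, E) x) : ℝ :=
  let G : Matrix ι ι ℝ := Matrix.of fun i j ↦ g.val x (b i) (b j)
  let t : Matrix ι ι ℝ := Matrix.of fun i j ↦ g.val x (T (b i)) (b j)
  ∑ i, ∑ j, ∑ r, ∑ s, G⁻¹ i r * G⁻¹ j s * t i j * t r s

end Metric

section Structures

variable {E : Type*} [NormedAddCommGroup E] [NormedSpace ℝ E]
  {M : Type*} [TopologicalSpace M] [ChartedSpace E M] [IsManifold 𝓘(ℝ, E) ∞ M]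

/-- The exterior derivative of a 1-form, with the normalization
`dη(X, Y) = ½ (X η(Y) - Y η(X) - η([X, Y]))`. -/
def extDerivOneForm (η : Π x : M, TangentSpace 𝓘(ℝ, E) x →L[ℝ] ℝ)
    (X Y : Π x : M, TangentSpace 𝓘(ℝ, E) x) (x : M) : ℝ :=
  (1 / 2 : ℝ) *
    (mvfderiv 𝓘(ℝ, E) (fun y ↦ η y (Y y)) x (X x)
      - mvfderiv 𝓘(ℝ, E) (fun y ↦ η y (X y)) x (Y x)
      - η x (mlieBracket 𝓘(ℝ, E) X Y x))

variable (E M) in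
/-- An almost paracontact structure `(φ, ξ, η)` on a manifold of dimension `2n + 1`. -/
structure AlmostParacontactStructure (n : ℕ) where
  /-- The tensor field of type `(1,1)`. -/
  φ (x : M) : TangentSpace 𝓘(ℝ, E) x →L[ℝ] TangentSpace 𝓘(ℝ, E) x
  /-- The vector field. -/
  ξ (x : M) : TangentSpace 𝓘(ℝ, E) x
  /-- The 1-form. -/
  η (x : M) : TangentSpace 𝓘(ℝ, E) x →L[ℝ] ℝ
  contMDiff_φ : ContMDiff 𝓘(ℝ, E) (𝓘(ℝ, E).prod 𝓘(ℝ, E →L[ℝ] E)) ∞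
    (fun x ↦ TotalSpace.mk' (E →L[ℝ] E)
      (E := fun x : M ↦ TangentSpace 𝓘(ℝ, E) x →L[ℝ] TangentSpace 𝓘(ℝ, E) x) x (φ x))
  contMDiff_ξ : CMDiff ∞ (T% ξ)
  contMDiff_η : ContMDiff 𝓘(ℝ, E) (𝓘(ℝ, E).prod 𝓘(ℝ, E →L[ℝ] ℝ)) ∞
    (fun x ↦ TotalSpace.mk' (E →L[ℝ] ℝ)
      (E := fun x : M ↦ TangentSpace 𝓘(ℝ, E) x →L[ℝ] ℝ) x (η x))
  finrank_eq : Module.finrank ℝ E = 2 * n + 1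
  φ_ξ (x : M) : φ x (ξ x) = 0
  η_φ (x : M) (v : TangentSpace 𝓘(ℝ, E) x) : η x (φ x v) = 0
  η_ξ (x : M) : η x (ξ x) = 1
  φ_φ (x : M) (v : TangentSpace 𝓘(ℝ, E) x) : φ x (φ x v) = v - η x v • ξ x
  /-- The eigenspace of `φ` on `ker η` for the eigenvalue `1` has dimension `n`. -/
  finrank_pos (x : M) : Module.finrank ℝ
    (Module.End.eigenspace (φ x).toLinearMap 1 ⊓ LinearMap.ker (η x).toLinearMap :
      Submodule ℝ (TangentSpace 𝓘(ℝ, E) x)) = n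
  /-- The eigenspace of `φ` on `ker η` for the eigenvalue `-1` has dimension `n`. -/
  finrank_neg (x : M) : Module.finrank ℝ
    (Module.End.eigenspace (φ x).toLinearMap (-1) ⊓ LinearMap.ker (η x).toLinearMap :
      Submodule ℝ (TangentSpace 𝓘(ℝ, E) x)) = n

variable (E M) in
/-- A paracontact metric structure `(φ, ξ, η, g)`: the metric is compatible with the almost
paracontact structure, and `g(X, φ Y) = dη(X, Y)`. -/
structure ParacontactMetricStructure (n : ℕ) extends AlmostParacontactStructure E M n where
  /-- The pseudo-Riemannian metric. -/
  g : PseudoRiemannianMetric E M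
  compatible (x : M) (v w : TangentSpace 𝓘(ℝ, E) x) :
    g.val x (φ x v) (φ x w) = -g.val x v w + η x v * η x w
  contact (x : M) (X Y : Π x : M, TangentSpace 𝓘(ℝ, E) x)
    (hX : CMDiffAt ∞ (T% X) x) (hY : CMDiffAt ∞ (T% Y) x) :
    g.val x (X x) (φ x (Y x)) = extDerivOneForm η X Y x

/-- The Lie derivative `(L_ξ φ) X = [ξ, φ X] - φ [ξ, X]`. -/
def AlmostParacontactStructure.lieDerivφ {n : ℕ} (S : AlmostParacontactStructure E M n)
    (X : Π x : M, TangentSpace 𝓘(ℝ, E) x) (x : M) : TangentSpace 𝓘(ℝ, E) x :=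
  mlieBracket 𝓘(ℝ, E) S.ξ (fun y ↦ S.φ y (X y)) x - S.φ x (mlieBracket 𝓘(ℝ, E) S.ξ X x)

theorem AlmostParacontactStructure.mdifferentiableAt_φ {n : ℕ}
    (S : AlmostParacontactStructure E M n) {X : Π x : M, TangentSpace 𝓘(ℝ, E) x} {x : M}
    (hX : MDiffAt (T% X) x) : MDiffAt (T% (fun y ↦ S.φ y (X y))) x := by
  apply MDifferentiableAt.clm_bundle_apply (F₁ := E) (F₂ := E)
  · exact S.contMDiff_φ.mdifferentiableAt (by simp)
  · exact hX

variable [FiniteDimensional ℝ E]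

theorem AlmostParacontactStructure.lieDerivφ_tensorial {n : ℕ}
    (S : AlmostParacontactStructure E M n) (x : M) :
    TensorialAt 𝓘(ℝ, E) E (fun X ↦ S.lieDerivφ X x) x where
  smul {f X} hf hX := by
    have hφ : (fun y ↦ S.φ y ((f • X) y)) = f • fun y ↦ S.φ y (X y) := by
      funext y
      simp
    simp only [lieDerivφ, hφ, mlieBracket_smul_right hf hX,
      mlieBracket_smul_right hf (S.mdifferentiableAt_φ hX)]
    simp [smul_sub]
  add {X X'} hX hX' := by
    have hφ : (fun y ↦ S.φ y ((X + X') y)) = (fun y ↦ S.φ y (X y)) + fun y ↦ S.φ y (X' y) := by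
      funext y
      simp
    simp only [lieDerivφ, hφ, mlieBracket_add_right hX hX',
      mlieBracket_add_right (S.mdifferentiableAt_φ hX) (S.mdifferentiableAt_φ hX')]
    simp
    abel

/-- The tensor field `h = ½ L_ξ φ`. -/
def AlmostParacontactStructure.h {n : ℕ} (S : AlmostParacontactStructure E M n) (x : M) :
    TangentSpace 𝓘(ℝ, E) x →L[ℝ] TangentSpace 𝓘(ℝ, E) x :=
  (1 / 2 : ℝ) • TensorialAt.mkHom (F := E) (fun X ↦ S.lieDerivφ X x) x (S.lieDerivφ_tensorial x)

theorem AlmostParacontactStructure.h_apply {n : ℕ} (S : AlmostParacontactStructure E M n)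
    {X : Π x : M, TangentSpace 𝓘(ℝ, E) x} {x : M} (hX : MDiffAt (T% X) x) :
    S.h x (X x) = (1 / 2 : ℝ) • S.lieDerivφ X x :=
  congrArg (fun v ↦ (1 / 2 : ℝ) • v)
    (TensorialAt.mkHom_apply (F := E) (Φ := fun X ↦ S.lieDerivφ X x) (S.lieDerivφ_tensorial x) hX)

end Structures

end Paracontact

end

/-!
Let `D₊` and `D₋` be the eigendistributions of `φ` on `ker η`; they are totally isotropic and dual
to each other under `g`. Write `∇ξ = -φ + B`. Since `dη(X, Y) = g(X, φ Y)`, the endomorphism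
`B` (`symmPart`) is self-adjoint, and one has `∇_ξ ξ = 0`.

For fields `X`, `Y`, `Z` of eigenvectors of `φ`, the closedness of `dη` becomes a single relation
between the numbers `g(Y, ∇_X Z)` (`closedness`). It gives that `∇_ξ` preserves `D₊` and `D₋`, that
`∇_X Z` stays in `D₊ ⊕ ℝ ξ` for `Z` in `D₊` and `X` in `D₋` (and conversely), and that `B` exchanges
`D₊` and `D₋`. Consequently `h = φ B`, and `h² = -B²`.

Constant sectional curvature determines the curvature tensor (`curvature_eq`); the planes on which
`g` degenerates are reached by a polynomial perturbation. The component of `R(X, ξ) ξ` between `D₊`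
and `D₋` then yields `B² = -(1 + c)` on `ker η` (`symmPart_symmPart`). So it remains to prove that
`c = -1`: then `h² = 0`, and `|h|²` is the trace of `h²` as `h` is self-adjoint.

Suppose that `c ≠ -1`, so that `B` is invertible on `ker η`. For `X`, `Y` in `D₊` and `Z` in `D₋`
the equation `g(R(X, Y) ξ, Z) = 0` reduces to `g([X, Y], B Z) = 0` (`val_leviCivita_swap`);
hence `g(∇_X Y, Z)` on `D₊` is symmetric in `X`, `Y` and skew in `Y`, `Z`, and so vanishes. Thus
all covariant derivatives of fields in `D₊` lie in `D₊ ⊕ ℝ ξ` (`val_leviCivita_eq_zero`), and for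
fields in `D₊` the vanishing of `g(R(X, Y) Z, W)` becomes the Gauss equation
`g(B X, Z) g(B Y, W) = g(B Y, Z) g(B X, W)` (`val_symmPart_mul`). A nondegenerate form on a space of
dimension `n ≥ 2` does not have rank one (`eq_neg_one`).
-/

noncomputable section

/-! ### Derivatives of functions and Lie brackets -/

namespace Paracontact

section Smoothness

variable {E : Type*} [NormedAddCommGroup E] [NormedSpace ℝ E]
  {M : Type*} [TopologicalSpace M] [ChartedSpace E M] [IsManifold 𝓘(ℝ, E) ∞ M]

theorem contMDiffAt_mvfderiv_apply {f : M → ℝ} {Y : Π x : M, TangentSpace 𝓘(ℝ, E) x} {x : M}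
    (hf : CMDiffAt ∞ f x) (hY : CMDiffAt ∞ (T% Y) x) :
    CMDiffAt ∞ (fun y ↦ mvfderiv 𝓘(ℝ, E) f y (Y y)) x := by
  have h : CMDiffAt ∞ (fun y ↦ (⟨f y, mfderiv 𝓘(ℝ, E) 𝓘(ℝ) f y (Y y)⟩ : TangentBundle 𝓘(ℝ) ℝ)) x :=
    ContMDiffAt.clm_apply_of_inCoordinates (b₁ := id) (b₂ := f)
      (ϕ := fun y ↦ mfderiv 𝓘(ℝ, E) 𝓘(ℝ) f y) (hf.mfderiv_const le_rfl) hY hf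
  have h2 := (contMDiffAt_totalSpace.1 h).2
  simpa using! h2

theorem PseudoRiemannianMetric.contMDiffAt_inner (g : PseudoRiemannianMetric E M)
    {X Y : Π x : M, TangentSpace 𝓘(ℝ, E) x} {x : M}
    (hX : CMDiffAt ∞ (T% X) x) (hY : CMDiffAt ∞ (T% Y) x) : CMDiffAt ∞ (g.inner X Y) x := by
  have h : ContMDiffAt 𝓘(ℝ, E) (𝓘(ℝ, E).prod 𝓘(ℝ)) ∞
      (fun m ↦ TotalSpace.mk' ℝ (E := Bundle.Trivial M ℝ) m (g.val m (X m) (Y m))) x := by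
    apply ContMDiffAt.clm_bundle_apply₂ (F₁ := E) (F₂ := E)
    · exact g.contMDiff.contMDiffAt
    · exact hX
    · exact hY
  exact (contMDiffAt_totalSpace.1 h).2

theorem contMDiffAt_mlieBracket [CompleteSpace E] {X Y : Π x : M, TangentSpace 𝓘(ℝ, E) x} {x : M}
    (hX : CMDiffAt ∞ (T% X) x) (hY : CMDiffAt ∞ (T% Y) x) :
    CMDiffAt ∞ (T% (mlieBracket 𝓘(ℝ, E) X Y)) x := by
  have : IsManifold 𝓘(ℝ, E) (((⊤ : ℕ∞) : ℕ∞ω) + 1) M := by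
    simpa using! (inferInstance : IsManifold 𝓘(ℝ, E) ∞ M)
  have : IsManifold 𝓘(ℝ, E) (minSmoothness ℝ 2) M :=
    IsManifold.of_le (n := ∞) (by simp only [minSmoothness_of_isRCLikeNormedField]; norm_cast)
  exact ContMDiffAt.mlieBracket_vectorField (m := ⊤) (n := ⊤) hX hY (by simp)

theorem eventually_mdifferentiableAt {X : Π x : M, TangentSpace 𝓘(ℝ, E) x} {x : M}
    (hX : CMDiffAt ∞ (T% X) x) : ∀ᶠ y in nhds x, MDiffAt (T% X) y := by
  have h1 : CMDiffAt 1 (T% X) x := hX.of_le (by norm_cast)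
  filter_upwards [(contMDiffAt_iff_contMDiffAt_nhds (by simp)).1 h1] with y hy
  exact hy.mdifferentiableAt one_ne_zero

theorem eventually_mdifferentiableAt_fun {f : M → ℝ} {x : M}
    (hf : CMDiffAt ∞ f x) : ∀ᶠ y in nhds x, MDiffAt f y := by
  have h1 : CMDiffAt 1 f x := hf.of_le (by norm_cast)
  filter_upwards [(contMDiffAt_iff_contMDiffAt_nhds (by simp)).1 h1] with y hy
  exact hy.mdifferentiableAt one_ne_zero

theorem jacobi_mlieBracket [CompleteSpace E]
    {X Y Z : Π x : M, TangentSpace 𝓘(ℝ, E) x} {x : M} (hX : CMDiffAt ∞ (T% X) x)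
    (hY : CMDiffAt ∞ (T% Y) x) (hZ : CMDiffAt ∞ (T% Z) x) :
    mlieBracket 𝓘(ℝ, E) X (mlieBracket 𝓘(ℝ, E) Y Z) x
      = mlieBracket 𝓘(ℝ, E) (mlieBracket 𝓘(ℝ, E) X Y) Z x
        + mlieBracket 𝓘(ℝ, E) Y (mlieBracket 𝓘(ℝ, E) X Z) x := by
  have hle : minSmoothness ℝ 2 ≤ (∞ : ℕ∞ω) := by
    simp only [minSmoothness_of_isRCLikeNormedField]; norm_cast
  have : IsManifold 𝓘(ℝ, E) (minSmoothness ℝ 3) M :=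
    IsManifold.of_le (n := ∞) (by
      simp only [minSmoothness_of_isRCLikeNormedField]; norm_cast)
  exact leibniz_identity_mlieBracket_apply (hX.of_le hle) (hY.of_le hle) (hZ.of_le hle)

/-- The Lie bracket is the commutator of derivations. This follows from the Jacobi identity for `X`,
`Y`, `f • Z` with `Z` nonvanishing at `x`, by comparing the coefficients of `Z`. -/
theorem mvfderiv_mlieBracket_apply [FiniteDimensional ℝ E]
    {X Y : Π x : M, TangentSpace 𝓘(ℝ, E) x} {f : M → ℝ} {x : M} (hX : CMDiffAt ∞ (T% X) x)
    (hY : CMDiffAt ∞ (T% Y) x) (hf : CMDiffAt ∞ f x) :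
    mvfderiv 𝓘(ℝ, E) f x (mlieBracket 𝓘(ℝ, E) X Y x)
      = mvfderiv 𝓘(ℝ, E) (fun y ↦ mvfderiv 𝓘(ℝ, E) f y (Y y)) x (X x)
        - mvfderiv 𝓘(ℝ, E) (fun y ↦ mvfderiv 𝓘(ℝ, E) f y (X y)) x (Y x) := by
  by_cases hE : Subsingleton E
  · have h0 : ∀ (y : M) (v : TangentSpace 𝓘(ℝ, E) y), v = 0 := fun y v ↦ hE.elim v (0 : E)
    rw [h0 x (mlieBracket 𝓘(ℝ, E) X Y x), h0 x (X x), h0 x (Y x)]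
    simp
  rw [not_subsingleton_iff_nontrivial] at hE
  obtain ⟨v, hv⟩ := exists_ne (0 : E)
  let Z : Π x : M, TangentSpace 𝓘(ℝ, E) x := 
    extend E (E := fun y : M ↦ TangentSpace 𝓘(ℝ, E) y) (x := x) v
  have hZ : CMDiffAt ∞ (T% Z) x := contMDiffAt_extend 𝓘(ℝ, E) E _
  have hZx : Z x ≠ 0 := by
    rw [show Z x = v from extend_apply_self (F := E) (E := fun y : M ↦ TangentSpace 𝓘(ℝ, E) y) v]
    exact hv
  have e1 : (∞ : ℕ∞ω) ≠ 0 := by simp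
  have hXd := hX.mdifferentiableAt e1
  have hYd := hY.mdifferentiableAt e1
  have hZd := hZ.mdifferentiableAt e1
  have hfd := hf.mdifferentiableAt e1
  have hXf := contMDiffAt_mvfderiv_apply hf hX
  have hYf := contMDiffAt_mvfderiv_apply hf hY
  have hXZ := contMDiffAt_mlieBracket hX hZ
  have hYZ := contMDiffAt_mlieBracket hY hZ
  have hfZ : CMDiffAt ∞ (T% (f • Z)) x := hf.smul_section hZ
  have key (V W : Π x : M, TangentSpace 𝓘(ℝ, E) x) (hW : CMDiffAt ∞ (T% W) x) :
      mlieBracket 𝓘(ℝ, E) V (mlieBracket 𝓘(ℝ, E) W (f • Z)) x =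
        mlieBracket 𝓘(ℝ, E) V
          ((fun y ↦ mvfderiv 𝓘(ℝ, E) f y (W y)) • Z + f • mlieBracket 𝓘(ℝ, E) W Z) x := by
    refine Filter.EventuallyEq.mlieBracket_vectorField_eq (Filter.EventuallyEq.refl _ _) ?_
    filter_upwards [eventually_mdifferentiableAt hZ, eventually_mdifferentiableAt_fun hf]
      with y hZy hfy
    exact mlieBracket_smul_right hfy hZy
  have J := jacobi_mlieBracket hX hY hfZ
  rw [key X Y hY, key Y X hX,
    mlieBracket_add_right, mlieBracket_add_right, mlieBracket_smul_right, mlieBracket_smul_right,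
    mlieBracket_smul_right, mlieBracket_smul_right, mlieBracket_smul_right,
    jacobi_mlieBracket hX hY hZ] at J
  · have : (mvfderiv 𝓘(ℝ, E) f x (mlieBracket 𝓘(ℝ, E) X Y x)
      - (mvfderiv 𝓘(ℝ, E) (fun y ↦ mvfderiv 𝓘(ℝ, E) f y (Y y)) x (X x)
        - mvfderiv 𝓘(ℝ, E) (fun y ↦ mvfderiv 𝓘(ℝ, E) f y (X y)) x (Y x))) • Z x = 0 := by
      rw [← sub_eq_zero] at J
      rw [← neg_eq_zero, ← J]
      module
    rw [← sub_eq_zero]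
    exact (smul_eq_zero.1 this).resolve_right hZx
  all_goals first
    | assumption
    | exact hXf.mdifferentiableAt e1
    | exact hYf.mdifferentiableAt e1
    | exact hXZ.mdifferentiableAt e1
    | exact hYZ.mdifferentiableAt e1
    | exact (hXf.mdifferentiableAt e1).smul_section hZd
    | exact (hYf.mdifferentiableAt e1).smul_section hZd
    | exact hfd.smul_section (hXZ.mdifferentiableAt e1)
    | exact hfd.smul_section (hYZ.mdifferentiableAt e1)

end Smoothness
end Paracontact

/-! ### Smoothness of the Levi-Civita connection -/

namespace Paracontact

section SmoothLeviCivita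

variable {E : Type*} [NormedAddCommGroup E] [NormedSpace ℝ E] [FiniteDimensional ℝ E]
  {M : Type*} [TopologicalSpace M] [ChartedSpace E M] [IsManifold 𝓘(ℝ, E) ∞ M]

/-- A covector field is smooth if its values on smooth vector fields are smooth. -/
theorem contMDiffAt_covector_of_apply {α : Π x : M, TangentSpace 𝓘(ℝ, E) x →L[ℝ] ℝ} {x : M}
    (h : ∀ W : Π x : M, TangentSpace 𝓘(ℝ, E) x, CMDiffAt ∞ (T% W) x →
      CMDiffAt ∞ (fun y ↦ α y (W y)) x) :
    ContMDiffAt 𝓘(ℝ, E) (𝓘(ℝ, E).prod 𝓘(ℝ, E →L[ℝ] ℝ)) ∞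
      (fun y ↦ TotalSpace.mk' (E →L[ℝ] ℝ)
        (E := fun y : M ↦ TangentSpace 𝓘(ℝ, E) y →L[ℝ] ℝ) y (α y)) x := by
  rw [contMDiffAt_hom_bundle]
  refine ⟨contMDiffAt_id, ?_⟩
  let b := Module.finBasis ℝ E
  -- the frame that is constant in the trivialization around `x`
  let W (i) : Π y : M, TangentSpace 𝓘(ℝ, E) y :=
    fun y ↦ (trivializationAt E (TangentSpace 𝓘(ℝ, E)) x).symm y (b i)
  have hW (i) : CMDiffAt ∞ (T% (W i)) x := by
    have := contMDiffAt_extend (k := ∞) 𝓘(ℝ, E) E (V := fun y : M ↦ TangentSpace 𝓘(ℝ, E) y)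
      (x := x) (W i x)
    refine this.congr_of_eventuallyEq (Filter.Eventually.of_forall fun y ↦ ?_)
    simp only [extend, W]
    rw [Trivialization.apply_mk_symm _ (FiberBundle.mem_baseSet_trivializationAt' x)]
  have hs : CMDiffAt ∞ (fun y ↦ ∑ i, α y (W i y) • (b.coord i).toContinuousLinearMap) x := by
    refine contMDiffAt_finsetSum fun i _ ↦ ?_
    exact (h _ (hW i)).smul contMDiffAt_const
  refine hs.congr_of_eventuallyEq ?_
  have hx : x ∈ (trivializationAt E (TangentSpace 𝓘(ℝ, E)) x).baseSet :=
    FiberBundle.mem_baseSet_trivializationAt' x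
  filter_upwards [(trivializationAt E (TangentSpace 𝓘(ℝ, E)) x).open_baseSet.mem_nhds hx] with y hy
  apply ContinuousLinearMap.coe_injective
  refine b.ext fun j ↦ ?_
  rw [ContinuousLinearMap.inCoordinates_eq hy (by simp)]
  simp [W, Finsupp.single_apply]

/-- A vector field is smooth if its inner products with smooth vector fields are smooth: in
coordinates it is obtained from the covector field `g(V, ·)` by applying the inverse of the
Gram matrix of `g`. -/
theorem PseudoRiemannianMetric.contMDiffAt_of_inner (g : PseudoRiemannianMetric E M)
    {V : Π x : M, TangentSpace 𝓘(ℝ, E) x} {x : M}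
    (h : ∀ W : Π x : M, TangentSpace 𝓘(ℝ, E) x, CMDiffAt ∞ (T% W) x →
      CMDiffAt ∞ (g.inner V W) x) : CMDiffAt ∞ (T% V) x := by
  have hα := contMDiffAt_covector_of_apply (α := fun y ↦ g.val y (V y)) h
  have hg := ((contMDiffAt_hom_bundle _).1 (g.contMDiff.contMDiffAt (x := x))).2
  have hx : x ∈ (trivializationAt E (TangentSpace 𝓘(ℝ, E)) x).baseSet :=
    FiberBundle.mem_baseSet_trivializationAt' x
  have hx' : x ∈ (trivializationAt (E →L[ℝ] ℝ)
      (fun y : M ↦ TangentSpace 𝓘(ℝ, E) y →L[ℝ] ℝ) x).baseSet :=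
    FiberBundle.mem_baseSet_trivializationAt' x
  have key : CMDiffAt ∞ (fun y ↦ ContinuousLinearMap.inCoordinates (E →L[ℝ] ℝ)
      (fun y : M ↦ TangentSpace 𝓘(ℝ, E) y →L[ℝ] ℝ) E (TangentSpace 𝓘(ℝ, E)) x y x y
      ((g.flat y).symm : (TangentSpace 𝓘(ℝ, E) y →L[ℝ] ℝ) →L[ℝ] TangentSpace 𝓘(ℝ, E) y)) x := by
    have hinv : CMDiffAt ∞ (ContinuousLinearMap.inverse ∘ fun y ↦
        ContinuousLinearMap.inCoordinates E (TangentSpace 𝓘(ℝ, E)) (E →L[ℝ] ℝ)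
        (fun y : M ↦ TangentSpace 𝓘(ℝ, E) y →L[ℝ] ℝ) x y x y (g.val y)) x := by
      refine ContMDiffAt.comp x (ContDiffAt.contMDiffAt ?_) hg
      apply ContinuousLinearMap.IsInvertible.contDiffAt_map_inverse
      rw [ContinuousLinearMap.inCoordinates_eq hx hx']
      refine ContinuousLinearMap.isInvertible_equiv.comp ?_
      exact ContinuousLinearMap.IsInvertible.comp
        (ContinuousLinearMap.isInvertible_equiv (f := g.flat x))
        ContinuousLinearMap.isInvertible_equiv
    refine hinv.congr_of_eventuallyEq ?_
    filter_upwards [(trivializationAt E (TangentSpace 𝓘(ℝ, E)) x).open_baseSet.mem_nhds hx,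
      (trivializationAt (E →L[ℝ] ℝ)
      (fun y : M ↦ TangentSpace 𝓘(ℝ, E) y →L[ℝ] ℝ) x).open_baseSet.mem_nhds hx'] with y hy hy'
    simp only [Function.comp_apply]
    rw [ContinuousLinearMap.inCoordinates_eq hy hy', ContinuousLinearMap.inCoordinates_eq hy' hy]
    have : g.val y = (g.flat y : TangentSpace 𝓘(ℝ, E) y →L[ℝ] (TangentSpace 𝓘(ℝ, E) y →L[ℝ] ℝ)) :=
      rfl
    rw [this]
    simp
    rfl
  have := ContMDiffAt.clm_apply_of_inCoordinates (b₁ := id) (b₂ := id)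
    (E₁ := fun y : M ↦ TangentSpace 𝓘(ℝ, E) y →L[ℝ] ℝ) (E₂ := fun y : M ↦ TangentSpace 𝓘(ℝ, E) y)
    (F₁ := E →L[ℝ] ℝ) (F₂ := E) (v := fun y ↦ g.val y (V y))
    (ϕ := fun y ↦ ((g.flat y).symm :
      (TangentSpace 𝓘(ℝ, E) y →L[ℝ] ℝ) →L[ℝ] TangentSpace 𝓘(ℝ, E) y)) key hα contMDiffAt_id
  refine this.congr_of_eventuallyEq (Filter.Eventually.of_forall fun y ↦ ?_)
  exact congrArg (fun v ↦ (⟨y, v⟩ : TangentBundle 𝓘(ℝ, E) M))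
    ((g.flat y).symm_apply_apply (V y)).symm

theorem PseudoRiemannianMetric.contMDiffAt_koszul (g : PseudoRiemannianMetric E M)
    {X Y Z : Π x : M, TangentSpace 𝓘(ℝ, E) x} {x : M}
    (hX : CMDiffAt ∞ (T% X) x) (hY : CMDiffAt ∞ (T% Y) x) (hZ : CMDiffAt ∞ (T% Z) x) :
    CMDiffAt ∞ (g.koszul X Y Z) x := by
  have h1 := contMDiffAt_mvfderiv_apply (g.contMDiffAt_inner hY hZ) hX
  have h2 := contMDiffAt_mvfderiv_apply (g.contMDiffAt_inner hZ hX) hY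
  have h3 := contMDiffAt_mvfderiv_apply (g.contMDiffAt_inner hX hY) hZ
  have h4 := g.contMDiffAt_inner (contMDiffAt_mlieBracket hX hY) hZ
  have h5 := g.contMDiffAt_inner (contMDiffAt_mlieBracket hZ hX) hY
  have h6 := g.contMDiffAt_inner (contMDiffAt_mlieBracket hY hZ) hX
  exact contMDiffAt_const.mul (((((h1.add h2).sub h3).add h4).add h5).sub h6)

theorem PseudoRiemannianMetric.contMDiffAt_leviCivita (g : PseudoRiemannianMetric E M)
    {Y Z : Π x : M, TangentSpace 𝓘(ℝ, E) x} {x : M}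
    (hY : CMDiffAt ∞ (T% Y) x) (hZ : CMDiffAt ∞ (T% Z) x) :
    CMDiffAt ∞ (T% (fun y ↦ g.leviCivita Z y (Y y))) x := by
  refine g.contMDiffAt_of_inner fun W hW ↦ ?_
  refine (g.contMDiffAt_koszul hY hZ hW).congr_of_eventuallyEq ?_
  filter_upwards [eventually_mdifferentiableAt hY, eventually_mdifferentiableAt hZ,
    eventually_mdifferentiableAt hW] with y h1 h2 h3
  exact g.val_leviCivitaFun h1 h2 h3

end SmoothLeviCivita
end Paracontact

/-! ### Algebraic curvature tensors -/

namespace Paracontact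

section CurvatureLike

variable {V : Type*} [AddCommGroup V] [Module ℝ V]

/-- The algebraic symmetries of a curvature tensor. Linearity in the second and fourth arguments
follows from the skew-symmetries. -/
structure IsCurvatureLike (D : V → V → V → V → ℝ) : Prop where
  add_left (X X' Y Z W) : D (X + X') Y Z W = D X Y Z W + D X' Y Z W
  smul_left (t : ℝ) (X Y Z W) : D (t • X) Y Z W = t * D X Y Z W
  add_third (X Y Z Z' W) : D X Y (Z + Z') W = D X Y Z W + D X Y Z' W
  smul_third (t : ℝ) (X Y Z W) : D X Y (t • Z) W = t * D X Y Z W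
  skew_left (X Y Z W) : D X Y Z W = -D Y X Z W
  skew_right (X Y Z W) : D X Y Z W = -D X Y W Z
  bianchi (X Y Z W) : D X Y Z W + D Y Z X W + D Z X Y W = 0

namespace IsCurvatureLike

variable {D D₀ : V → V → V → V → ℝ}

theorem add_second (h : IsCurvatureLike D) (X Y Y' Z W) :
    D X (Y + Y') Z W = D X Y Z W + D X Y' Z W := by
  rw [h.skew_left, h.add_left, h.skew_left X, h.skew_left X Y']
  ring

theorem smul_second (h : IsCurvatureLike D) (t : ℝ) (X Y Z W) :
    D X (t • Y) Z W = t * D X Y Z W := by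
  rw [h.skew_left, h.smul_left, h.skew_left X]
  ring

theorem add_fourth (h : IsCurvatureLike D) (X Y Z W W') :
    D X Y Z (W + W') = D X Y Z W + D X Y Z W' := by
  rw [h.skew_right, h.add_third, h.skew_right X Y Z, h.skew_right X Y Z W']
  ring

theorem smul_fourth (h : IsCurvatureLike D) (t : ℝ) (X Y Z W) :
    D X Y Z (t • W) = t * D X Y Z W := by
  rw [h.skew_right, h.smul_third, h.skew_right X Y Z]
  ring

theorem pair_symm (h : IsCurvatureLike D) (X Y Z W) : D X Y Z W = D Z W X Y := by
  have h1 := h.bianchi X Y Z W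
  have h2 := h.bianchi Y Z W X
  have h3 := h.bianchi Z W X Y
  have h4 := h.bianchi W X Y Z
  rw [h.skew_right Y Z X W] at h1
  rw [h.skew_right Z W Y X, h.skew_left W Y Z X] at h2
  rw [h.skew_left X Z W Y, h.skew_right W X Z Y, h.skew_right Z X W Y] at h3
  rw [h.skew_right X Y W Z, h.skew_right Y W X Z] at h4
  linarith

theorem sub_smul (h : IsCurvatureLike D) (h₀ : IsCurvatureLike D₀) (c : ℝ) :
    IsCurvatureLike fun X Y Z W ↦ D X Y Z W - c * D₀ X Y Z W where
  add_left _ _ _ _ _ := by rw [h.add_left, h₀.add_left]; ring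
  smul_left _ _ _ _ _ := by rw [h.smul_left, h₀.smul_left]; ring
  add_third _ _ _ _ _ := by rw [h.add_third, h₀.add_third]; ring
  smul_third _ _ _ _ _ := by rw [h.smul_third, h₀.smul_third]; ring
  skew_left X Y Z W := by rw [h.skew_left, h₀.skew_left]; ring
  skew_right X Y Z W := by rw [h.skew_right, h₀.skew_right]; ring
  bianchi X Y Z W := by
    linear_combination h.bianchi X Y Z W - c * h₀.bianchi X Y Z W

/-- A curvature tensor is determined by its sectional values. -/
theorem eq_zero_of_sectional (h : IsCurvatureLike D) (h0 : ∀ X Y, D X Y Y X = 0) (X Y Z W) :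
    D X Y Z W = 0 := by
  have h1 (X Y Z) : D X Y Y Z = 0 := by
    have e := h0 (X + Z) Y
    rw [h.add_left, h.add_fourth, h.add_fourth, h0, h0, h.pair_symm Z Y Y X,
      h.skew_left Y X Z Y, h.skew_right X Y Z Y] at e
    linarith
  have h2 (X Y Z W) : D X Y Z W = -D X Z Y W := by
    have e := h1 X (Y + Z) W
    rw [h.add_second, h.add_third, h.add_third, h1, h1] at e
    linarith
  have e := h.bianchi X Y Z W
  have e1 := h2 Y Z X W
  have e2 := h2 X Y Z W
  have e3 := h.skew_left Z X Y W
  have e4 := h.skew_left Y X Z W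
  linarith

/-- The sectional values along two affine lines of vectors are polynomial of degree four, with the
sectional value of the two directions as leading coefficient. -/
theorem quartic (h : IsCurvatureLike D) (X Y X' Y') : ∃ a b d : ℝ, ∀ t : ℝ,
    D (X + t • X') (Y + t • Y') (Y + t • Y') (X + t • X')
      = D X Y Y X + a * t + b * t ^ 2 + d * t ^ 3 + D X' Y' Y' X' * t ^ 4 := by
  refine ⟨D X' Y Y X + D X Y' Y X + D X Y Y' X + D X Y Y X',
    D X' Y' Y X + D X' Y Y' X + D X' Y Y X' + D X Y' Y' X + D X Y' Y X' + D X Y Y' X',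
    D X' Y' Y' X + D X' Y' Y X' + D X' Y Y' X' + D X Y' Y' X', fun t ↦ ?_⟩
  simp only [h.add_left, h.add_second, h.add_third, h.add_fourth, h.smul_left, h.smul_second,
    h.smul_third, h.smul_fourth]
  ring

open Polynomial in
/-- If the sectional values of `D` are `c` times those of `D₀` on all planes on which `D₀` does
not vanish, and there is such a plane, then `D = c D₀`: the other planes are limits of such
planes, along which both sides are polynomial. -/
theorem eq_of_sectional_of_ne_zero (h : IsCurvatureLike D) (h₀ : IsCurvatureLike D₀) {c : ℝ}
    (hc : ∀ X Y, D₀ X Y Y X ≠ 0 → D X Y Y X = c * D₀ X Y Y X)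
    (hne : ∃ X Y, D₀ X Y Y X ≠ 0) (X Y Z W) : D X Y Z W = c * D₀ X Y Z W := by
  have hs := h.sub_smul h₀ c
  refine sub_eq_zero.1 (hs.eq_zero_of_sectional (fun X Y ↦ ?_) X Y Z W)
  obtain ⟨X', Y', hXY'⟩ := hne
  obtain ⟨a, b, d, hp⟩ := h₀.quartic X Y X' Y'
  obtain ⟨a', b', d', hq⟩ := hs.quartic X Y X' Y'
  let p : ℝ[X] := C (D₀ X Y Y X) + C a * Polynomial.X + C b * Polynomial.X ^ 2
    + C d * Polynomial.X ^ 3 + C (D₀ X' Y' Y' X') * Polynomial.X ^ 4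
  let q : ℝ[X] := C (D X Y Y X - c * D₀ X Y Y X) + C a' * Polynomial.X + C b' * Polynomial.X ^ 2
    + C d' * Polynomial.X ^ 3 + C (D X' Y' Y' X' - c * D₀ X' Y' Y' X') * Polynomial.X ^ 4
  have hpe (t : ℝ) : p.eval t = D₀ (X + t • X') (Y + t • Y') (Y + t • Y') (X + t • X') := by
    rw [hp]; simp [p]
  have hqe (t : ℝ) : q.eval t = D (X + t • X') (Y + t • Y') (Y + t • Y') (X + t • X')
      - c * D₀ (X + t • X') (Y + t • Y') (Y + t • Y') (X + t • X') := by
    rw [hq]; simp [q]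
  have hpq : q * p = 0 := by
    refine Polynomial.funext fun t ↦ ?_
    rw [eval_mul, eval_zero, mul_eq_zero, hpe, hqe]
    by_contra! hcon
    exact hcon.1 (sub_eq_zero.2 (hc _ _ hcon.2))
  have hp0 : p ≠ 0 := by
    intro e
    have : p.coeff 4 = D₀ X' Y' Y' X' := by
      simp [p]
    exact hXY' (by rw [← this, e, coeff_zero])
  have hq0 : q = 0 := (mul_eq_zero.1 hpq).resolve_right hp0
  have := hqe 0
  simpa [hq0] using this.symm

end IsCurvatureLike

end CurvatureLike
end Paracontact

/-! ### Curvature of a pseudo-Riemannian metric -/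

namespace Paracontact

section Curvature

variable {E : Type*} [NormedAddCommGroup E] [NormedSpace ℝ E]
  {M : Type*} [TopologicalSpace M] [ChartedSpace E M]

theorem mvfderiv_congr {f f' : M → ℝ} {x : M} (h : f =ᶠ[nhds x] f') :
    mvfderiv 𝓘(ℝ, E) f x = mvfderiv 𝓘(ℝ, E) f' x := by
  ext v
  have := h.mfderiv_eq (I := 𝓘(ℝ, E)) (I' := 𝓘(ℝ))
  exact congrArg (fun l : E →L[ℝ] ℝ ↦ l v) this

variable [IsManifold 𝓘(ℝ, E) ∞ M]

theorem mdifferentiableAt_of_smooth {X : Π x : M, TangentSpace 𝓘(ℝ, E) x} {x : M}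
    (hX : CMDiffAt ∞ (T% X) x) : MDiffAt (T% X) x :=
  hX.mdifferentiableAt (by simp)

variable (E) in
/-- The real vector space of vector fields that are smooth at `x`. -/
def smoothFields (x : M) : Submodule ℝ (Π y : M, TangentSpace 𝓘(ℝ, E) y) where
  carrier := {X | CMDiffAt ∞ (T% X) x}
  add_mem' hX hY := ContMDiffAt.add_section hX hY
  zero_mem' := contMDiffAt_zeroSection ℝ _
  smul_mem' _ _ hX := ContMDiffAt.const_smul_section hX

namespace PseudoRiemannianMetric

/-- The curvature tensor of constant sectional curvature one. -/
theorem isCurvatureLike_inner (g : PseudoRiemannianMetric E M) (x : M) :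
    IsCurvatureLike fun X Y Z W : smoothFields E x ↦
      g.val x (Y.1 x) (Z.1 x) * g.val x (X.1 x) (W.1 x)
      - g.val x (X.1 x) (Z.1 x) * g.val x (Y.1 x) (W.1 x) where
  add_left X X' Y Z W := by simp; ring
  smul_left t X Y Z W := by simp; ring
  add_third X Y Z Z' W := by simp; ring
  smul_third t X Y Z W := by simp; ring
  skew_left X Y Z W := by ring
  skew_right X Y Z W := by ring
  bianchi X Y Z W := by
    rw [g.symm x (Z.1 x) (X.1 x), g.symm x (Z.1 x) (Y.1 x), g.symm x (Y.1 x) (X.1 x)]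
    ring

variable [FiniteDimensional ℝ E] (g : PseudoRiemannianMetric E M) {x : M}
  {X Y Z W : Π x : M, TangentSpace 𝓘(ℝ, E) x}

theorem leviCivita_add (hX : CMDiffAt ∞ (T% X) x) (hY : CMDiffAt ∞ (T% Y) x) :
    g.leviCivita (X + Y) x = g.leviCivita X x + g.leviCivita Y x :=
  g.leviCivita.isCovariantDerivativeOnUniv.add (mdifferentiableAt_of_smooth hX)
    (mdifferentiableAt_of_smooth hY)

theorem leviCivita_const_smul (t : ℝ) (hX : CMDiffAt ∞ (T% X) x) :
    g.leviCivita (t • X) x = t • g.leviCivita X x :=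
  g.leviCivita.isCovariantDerivativeOnUniv.smul_const t (mdifferentiableAt_of_smooth hX)

theorem leviCivita_sub (hX : CMDiffAt ∞ (T% X) x) (hY : CMDiffAt ∞ (T% Y) x) :
    g.leviCivita (X - Y) x = g.leviCivita X x - g.leviCivita Y x := by
  have h := ContMDiffAt.const_smul_section (a := (-1 : ℝ)) hY
  rw [show X - Y = X + (-1 : ℝ) • Y by simp [sub_eq_add_neg], g.leviCivita_add hX h,
    g.leviCivita_const_smul _ hY]
  simp [sub_eq_add_neg]

theorem leviCivita_congr (hX : CMDiffAt ∞ (T% X) x) (hY : CMDiffAt ∞ (T% Y) x)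
    (h : ∀ᶠ y in nhds x, X y = Y y) : g.leviCivita X x = g.leviCivita Y x :=
  g.leviCivita.isCovariantDerivativeOnUniv.congr_of_eventuallyEq
    (mdifferentiableAt_of_smooth hX) (mdifferentiableAt_of_smooth hY) Filter.univ_mem h

/-- The Levi-Civita connection is metric, in the direction of a single tangent vector. -/
theorem mvfderiv_inner_apply (hY : CMDiffAt ∞ (T% Y) x) (hZ : CMDiffAt ∞ (T% Z) x)
    (v : TangentSpace 𝓘(ℝ, E) x) :
    mvfderiv 𝓘(ℝ, E) (g.inner Y Z) x v
      = g.val x (g.leviCivita Y x v) (Z x) + g.val x (Y x) (g.leviCivita Z x v) := by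
  have := g.leviCivita_metric (mdifferentiableAt_extend 𝓘(ℝ, E) E v)
    (mdifferentiableAt_of_smooth hY) (mdifferentiableAt_of_smooth hZ)
  simpa only [extend_apply_self] using this

theorem mlieBracket_eq (hX : CMDiffAt ∞ (T% X) x) (hY : CMDiffAt ∞ (T% Y) x) :
    mlieBracket 𝓘(ℝ, E) X Y x = g.leviCivita Y x (X x) - g.leviCivita X x (Y x) :=
  (g.leviCivita_torsion_free (mdifferentiableAt_of_smooth hX) (mdifferentiableAt_of_smooth hY)).symm

theorem curvature_skew_left : g.curvature X Y Z x = -g.curvature Y X Z x := by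
  simp only [curvature, mlieBracket_swap_apply (V := X) (W := Y), map_neg]
  abel

theorem curvature_add_left {X' : Π x : M, TangentSpace 𝓘(ℝ, E) x} (hX : CMDiffAt ∞ (T% X) x)
    (hX' : CMDiffAt ∞ (T% X') x) (hZ : CMDiffAt ∞ (T% Z) x) :
    g.curvature (X + X') Y Z x = g.curvature X Y Z x + g.curvature X' Y Z x := by
  have h : (fun y ↦ g.leviCivita Z y ((X + X') y))
      = (fun y ↦ g.leviCivita Z y (X y)) + fun y ↦ g.leviCivita Z y (X' y) := by
    funext y; simp
  simp only [curvature, h, g.leviCivita_add (g.contMDiffAt_leviCivita hX hZ)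
    (g.contMDiffAt_leviCivita hX' hZ), mlieBracket_add_left (mdifferentiableAt_of_smooth hX)
    (mdifferentiableAt_of_smooth hX')]
  simp
  abel

theorem curvature_smul_left (t : ℝ) (hX : CMDiffAt ∞ (T% X) x) (hZ : CMDiffAt ∞ (T% Z) x) :
    g.curvature (t • X) Y Z x = t • g.curvature X Y Z x := by
  have h : (fun y ↦ g.leviCivita Z y ((t • X) y)) = t • fun y ↦ g.leviCivita Z y (X y) := by
    funext y; simp
  simp only [curvature, h, g.leviCivita_const_smul t (g.contMDiffAt_leviCivita hX hZ),
    mlieBracket_const_smul_left (mdifferentiableAt_of_smooth hX)]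
  simp [smul_sub]

theorem curvature_add_third {Z' : Π x : M, TangentSpace 𝓘(ℝ, E) x} (hX : CMDiffAt ∞ (T% X) x)
    (hY : CMDiffAt ∞ (T% Y) x) (hZ : CMDiffAt ∞ (T% Z) x) (hZ' : CMDiffAt ∞ (T% Z') x) :
    g.curvature X Y (Z + Z') x = g.curvature X Y Z x + g.curvature X Y Z' x := by
  have h (V W : Π x : M, TangentSpace 𝓘(ℝ, E) x) (hV : CMDiffAt ∞ (T% V) x) :
      g.leviCivita (fun y ↦ g.leviCivita (Z + Z') y (V y)) x
      = g.leviCivita (fun y ↦ g.leviCivita Z y (V y)) x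
        + g.leviCivita (fun y ↦ g.leviCivita Z' y (V y)) x := by
    rw [← g.leviCivita_add (g.contMDiffAt_leviCivita hV hZ) (g.contMDiffAt_leviCivita hV hZ')]
    refine g.leviCivita_congr (g.contMDiffAt_leviCivita hV (ContMDiffAt.add_section hZ hZ'))
      (ContMDiffAt.add_section (g.contMDiffAt_leviCivita hV hZ) (g.contMDiffAt_leviCivita hV hZ')) ?_
    filter_upwards [eventually_mdifferentiableAt hZ, eventually_mdifferentiableAt hZ'] with y h1 h2
    rw [g.leviCivita.isCovariantDerivativeOnUniv.add h1 h2]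
    rfl
  rw [curvature, h X X hX, h Y Y hY, g.leviCivita_add hZ hZ']
  simp only [curvature, add_apply]
  abel

theorem curvature_smul_third (t : ℝ) (hX : CMDiffAt ∞ (T% X) x)
    (hY : CMDiffAt ∞ (T% Y) x) (hZ : CMDiffAt ∞ (T% Z) x) :
    g.curvature X Y (t • Z) x = t • g.curvature X Y Z x := by
  have h (V : Π x : M, TangentSpace 𝓘(ℝ, E) x) (hV : CMDiffAt ∞ (T% V) x) :
      g.leviCivita (fun y ↦ g.leviCivita (t • Z) y (V y)) x
      = t • g.leviCivita (fun y ↦ g.leviCivita Z y (V y)) x := by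
    rw [← g.leviCivita_const_smul t (g.contMDiffAt_leviCivita hV hZ)]
    refine g.leviCivita_congr (g.contMDiffAt_leviCivita hV (ContMDiffAt.const_smul_section hZ))
      (ContMDiffAt.const_smul_section (g.contMDiffAt_leviCivita hV hZ)) ?_
    filter_upwards [eventually_mdifferentiableAt hZ] with y h1
    have := g.leviCivita.isCovariantDerivativeOnUniv.smul_const t h1
    exact congrArg (fun l ↦ l (V y)) this
  rw [curvature, h X hX, h Y hY, g.leviCivita_const_smul t hZ]
  simp [curvature, smul_sub]

theorem curvature_bianchi (hX : CMDiffAt ∞ (T% X) x)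
    (hY : CMDiffAt ∞ (T% Y) x) (hZ : CMDiffAt ∞ (T% Z) x) :
    g.curvature X Y Z x + g.curvature Y Z X x + g.curvature Z X Y x = 0 := by
  -- `∇_U (∇_V W) - ∇_U (∇_W V) = ∇_[V, W] U + [U, [V, W]]` since the torsion vanishes
  have h (U V W : Π x : M, TangentSpace 𝓘(ℝ, E) x) (hU : CMDiffAt ∞ (T% U) x)
      (hV : CMDiffAt ∞ (T% V) x) (hW : CMDiffAt ∞ (T% W) x) :
      g.leviCivita (fun y ↦ g.leviCivita W y (V y)) x (U x)
        - g.leviCivita (fun y ↦ g.leviCivita V y (W y)) x (U x)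
      = g.leviCivita U x (mlieBracket 𝓘(ℝ, E) V W x)
        + mlieBracket 𝓘(ℝ, E) U (mlieBracket 𝓘(ℝ, E) V W) x := by
    have h1 := g.contMDiffAt_leviCivita hV hW
    have h2 := g.contMDiffAt_leviCivita hW hV
    have h3 := contMDiffAt_mlieBracket hV hW
    have e := g.leviCivita_sub h1 h2
    have e2 := g.leviCivita_congr (ContMDiffAt.sub_section h1 h2) h3 (by
      filter_upwards [eventually_mdifferentiableAt hV, eventually_mdifferentiableAt hW] with y a b
      exact g.leviCivita_torsion_free a b)
    rw [g.mlieBracket_eq hU h3, ← e2, e]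
    simp
  have e1 := h X Y Z hX hY hZ
  have e2 := h Y Z X hY hZ hX
  have e3 := h Z X Y hZ hX hY
  have J := jacobi_mlieBracket hX hY hZ
  rw [mlieBracket_swap_apply (V := mlieBracket 𝓘(ℝ, E) X Y)] at J
  have s1 : mlieBracket 𝓘(ℝ, E) Y (mlieBracket 𝓘(ℝ, E) X Z) x
      = -mlieBracket 𝓘(ℝ, E) Y (mlieBracket 𝓘(ℝ, E) Z X) x := by
    rw [mlieBracket_swap (V := X) (W := Z), mlieBracket_swap_apply, mlieBracket_swap_apply (V := Y)]
    have := mlieBracket_const_smul_left (I := 𝓘(ℝ, E)) (c := (-1 : ℝ)) (W := Y)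
      (mdifferentiableAt_of_smooth (contMDiffAt_mlieBracket hZ hX))
    rw [neg_one_smul, neg_one_smul] at this
    rw [this]
  rw [s1] at J
  simp only [curvature]
  rw [sub_eq_iff_eq_add] at e1 e2 e3
  rw [e1, e2, e3, J]
  abel

theorem curvature_skew_right (hX : CMDiffAt ∞ (T% X) x)
    (hY : CMDiffAt ∞ (T% Y) x) (hZ : CMDiffAt ∞ (T% Z) x) (hW : CMDiffAt ∞ (T% W) x) :
    g.val x (g.curvature X Y Z x) (W x) = -g.val x (g.curvature X Y W x) (Z x) := by
  have h (U V : Π x : M, TangentSpace 𝓘(ℝ, E) x) (hU : CMDiffAt ∞ (T% U) x)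
      (hV : CMDiffAt ∞ (T% V) x) :
      mvfderiv 𝓘(ℝ, E) (fun y ↦ mvfderiv 𝓘(ℝ, E) (g.inner Z W) y (V y)) x (U x)
        = g.val x (g.leviCivita (fun y ↦ g.leviCivita Z y (V y)) x (U x)) (W x)
          + g.val x (g.leviCivita Z x (V x)) (g.leviCivita W x (U x))
          + (g.val x (g.leviCivita Z x (U x)) (g.leviCivita W x (V x))
          + g.val x (Z x) (g.leviCivita (fun y ↦ g.leviCivita W y (V y)) x (U x))) := by
    have hVZ := g.contMDiffAt_leviCivita hV hZ
    have hVW := g.contMDiffAt_leviCivita hV hW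
    have e : (fun y ↦ mvfderiv 𝓘(ℝ, E) (g.inner Z W) y (V y)) =ᶠ[nhds x]
        g.inner (fun y ↦ g.leviCivita Z y (V y)) W + g.inner Z (fun y ↦ g.leviCivita W y (V y)) := by
      filter_upwards [eventually_mdifferentiableAt hV, eventually_mdifferentiableAt hZ,
        eventually_mdifferentiableAt hW] with y a b d
      exact g.leviCivita_metric a b d
    rw [mvfderiv_congr e, mvfderiv_add (g.mdifferentiableAt_inner (mdifferentiableAt_of_smooth hVZ)
      (mdifferentiableAt_of_smooth hW)) (g.mdifferentiableAt_inner (mdifferentiableAt_of_smooth hZ)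
      (mdifferentiableAt_of_smooth hVW)), add_apply,
      g.mvfderiv_inner_apply hVZ hW, g.mvfderiv_inner_apply hZ hVW]
  have e := mvfderiv_mlieBracket_apply hX hY (g.contMDiffAt_inner hZ hW)
  rw [h X Y hX hY, h Y X hY hX, g.mvfderiv_inner_apply hZ hW] at e
  simp only [curvature, map_sub, sub_apply]
  simp only [g.symm x _ (Z x)]
  linarith

/-- The curvature tensor, on the space of vector fields that are smooth at `x`. -/
theorem isCurvatureLike_curvature (x : M) :
    IsCurvatureLike fun X Y Z W : smoothFields E x ↦ g.val x (g.curvature X Y Z x) (W.1 x) where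
  add_left X X' Y Z W := by
    simp [g.curvature_add_left X.2 X'.2 Z.2]
  smul_left t X Y Z W := by
    simp [g.curvature_smul_left t X.2 Z.2]
  add_third X Y Z Z' W := by
    simp [g.curvature_add_third X.2 Y.2 Z.2 Z'.2]
  smul_third t X Y Z W := by
    simp [g.curvature_smul_third t X.2 Y.2 Z.2]
  skew_left X Y Z W := by
    rw [g.curvature_skew_left]; simp
  skew_right X Y Z W := g.curvature_skew_right X.2 Y.2 Z.2 W.2
  bianchi X Y Z W := by
    simp only [← add_apply, ← map_add, g.curvature_bianchi X.2 Y.2 Z.2]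
    simp

/-- Constant sectional curvature determines the curvature tensor. -/
theorem HasConstantSectionalCurvature.curvature_eq {g : PseudoRiemannianMetric E M} {c : ℝ}
    (hc : g.HasConstantSectionalCurvature c)
    (hne : ∃ v w : TangentSpace 𝓘(ℝ, E) x, g.val x v v * g.val x w w - g.val x v w ^ 2 ≠ 0)
    (hX : CMDiffAt ∞ (T% X) x) (hY : CMDiffAt ∞ (T% Y) x) (hZ : CMDiffAt ∞ (T% Z) x) :
    g.curvature X Y Z x = c • (g.val x (Y x) (Z x) • X x - g.val x (X x) (Z x) • Y x) := by
  refine g.eq_of_forall_val fun w ↦ ?_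
  have := (g.isCurvatureLike_curvature x).eq_of_sectional_of_ne_zero (g.isCurvatureLike_inner x)
    (c := c) (fun X Y hXY ↦ ?_) ?_ ⟨X, hX⟩ ⟨Y, hY⟩ ⟨Z, hZ⟩
    ⟨extend E w, contMDiffAt_extend 𝓘(ℝ, E) E w⟩
  · simpa using this
  · have hA : g.areaSq X Y x ≠ 0 := by
      convert hXY using 1
      simp only [areaSq, inner_apply, g.symm x (Y.1 x) (X.1 x)]
      ring
    have := hc x X Y X.2 Y.2 hA
    rw [sectionalCurvature, div_eq_iff hA] at this
    rw [← g.inner_apply, this]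
    simp only [areaSq, inner_apply, g.symm x (Y.1 x) (X.1 x)]
    ring
  · obtain ⟨v, w, h⟩ := hne
    refine ⟨⟨extend E v, contMDiffAt_extend 𝓘(ℝ, E) E v⟩,
      ⟨extend E w, contMDiffAt_extend 𝓘(ℝ, E) E w⟩, ?_⟩
    convert h using 1
    simp [g.symm x w v]
    ring

end PseudoRiemannianMetric
end Curvature
end Paracontact

/-! ### Pointwise algebra of a paracontact metric structure -/

namespace Paracontact
namespace ParacontactMetricStructure

variable {E : Type*} [NormedAddCommGroup E] [NormedSpace ℝ E]
  {M : Type*} [TopologicalSpace M] [ChartedSpace E M] [IsManifold 𝓘(ℝ, E) ∞ M]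
  {n : ℕ} (S : ParacontactMetricStructure E M n)

theorem val_ξ (x : M) (v : TangentSpace 𝓘(ℝ, E) x) : S.g.val x (S.ξ x) v = S.η x v := by
  have := S.compatible x v (S.ξ x)
  rw [S.φ_ξ, S.η_ξ, map_zero, S.g.symm x v] at this
  linarith

theorem val_φ_left (x : M) (v w : TangentSpace 𝓘(ℝ, E) x) :
    S.g.val x (S.φ x v) w = -S.g.val x v (S.φ x w) := by
  have := S.compatible x v (S.φ x w)
  rw [S.φ_φ, S.η_φ, map_sub, map_smul, S.g.symm x _ (S.ξ x), S.val_ξ, S.η_φ] at this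
  simpa using this

theorem φ_eq_of_mem_eigenspace {x : M} {v : TangentSpace 𝓘(ℝ, E) x} (hv : v ∈
    (Module.End.eigenspace (S.φ x).toLinearMap 1 ⊓ LinearMap.ker (S.η x).toLinearMap :
      Submodule ℝ (TangentSpace 𝓘(ℝ, E) x))) : S.φ x v = (1 : ℝ) • v :=
  Module.End.mem_eigenspace_iff.1 hv.1

/-- An eigenvector of `φ` for a nonzero eigenvalue is annihilated by `η`. -/
theorem η_eq_zero {x : M} {e : ℝ} (he : e ≠ 0) {v : TangentSpace 𝓘(ℝ, E) x}
    (hv : S.φ x v = e • v) : S.η x v = 0 := by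
  have := S.η_φ x v
  rw [hv, map_smul, smul_eq_mul, mul_eq_zero] at this
  exact this.resolve_left he

theorem val_eq_zero_of_same_sign {x : M} {e : ℝ} (he : e ^ 2 = 1)
    {v w : TangentSpace 𝓘(ℝ, E) x} (hv : S.φ x v = e • v) (hw : S.φ x w = e • w) :
    S.g.val x v w = 0 := by
  have e0 : e ≠ 0 := by rintro rfl; norm_num at he
  have := S.compatible x v w
  rw [hv, hw, S.η_eq_zero e0 hv] at this
  simp only [map_smul, smul_apply, smul_eq_mul] at this
  linear_combination (1 / 2 : ℝ) * this - (1 / 2 : ℝ) * S.g.val x v w * he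

/-- Every tangent vector is a sum of eigenvectors of `φ` for the eigenvalues `1`, `-1` and of a
multiple of `ξ`. -/
theorem induction_decomp {x : M} {P : TangentSpace 𝓘(ℝ, E) x → Prop}
    (hadd : ∀ v w, P v → P w → P (v + w))
    (hsign : ∀ (e : ℝ) (v), e ^ 2 = 1 → S.φ x v = e • v → P v)
    (hξ : ∀ t : ℝ, P (t • S.ξ x)) (v : TangentSpace 𝓘(ℝ, E) x) : P v := by
  have h1 : S.φ x (S.φ x (S.φ x v)) = S.φ x v := by rw [S.φ_φ, S.η_φ]; simp
  have hv : v = ((1 / 2 : ℝ) • (S.φ x (S.φ x v) + S.φ x v)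
      + (1 / 2 : ℝ) • (S.φ x (S.φ x v) - S.φ x v)) + S.η x v • S.ξ x := by
    rw [S.φ_φ]; module
  rw [hv]
  refine hadd _ _ (hadd _ _ (hsign 1 _ (by norm_num) ?_) (hsign (-1) _ (by norm_num) ?_)) (hξ _)
  · simp only [map_smul, map_add, h1]; module
  · simp only [map_smul, map_sub, h1]; module

theorem eq_zero_of_val {x : M} {u : TangentSpace 𝓘(ℝ, E) x} (hη : S.η x u = 0)
    (h : ∀ (e : ℝ) (w), e ^ 2 = 1 → S.φ x w = e • w → S.g.val x u w = 0) : u = 0 := by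
  refine S.g.nondegenerate x u fun w ↦ ?_
  refine S.induction_decomp (P := fun w ↦ S.g.val x u w = 0) ?_ h ?_ w
  · intro v w hv hw; rw [map_add, hv, hw, add_zero]
  · intro t; rw [map_smul, S.g.symm, S.val_ξ, hη, smul_zero]

/-- Each eigenspace of `φ` on `ker η` is its own orthogonal complement in `ker η`. -/
theorem φ_eq_of_val {x : M} {e : ℝ} (he : e ^ 2 = 1) {u : TangentSpace 𝓘(ℝ, E) x}
    (hη : S.η x u = 0) (h : ∀ w, S.φ x w = e • w → S.g.val x u w = 0) : S.φ x u = e • u := by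
  rw [← sub_eq_zero]
  have e0 : e ≠ 0 := by rintro rfl; norm_num at he
  have hz : S.φ x (S.φ x u - e • u) = (-e) • (S.φ x u - e • u) := by
    rw [map_sub, map_smul, S.φ_φ, hη, zero_smul, sub_zero, smul_sub, smul_smul,
      show -e * e = -1 by linear_combination -he]
    module
  refine S.eq_zero_of_val (S.η_eq_zero (neg_ne_zero.2 e0) hz) fun f w hf hw ↦ ?_
  have hfe : f = e ∨ f = -e := by
    rw [← sq_eq_sq_iff_eq_or_eq_neg, hf, he]
  rcases hfe with rfl | rfl
  · rw [map_sub, sub_apply, S.val_φ_left, map_smul, smul_apply, hw, map_smul, h w hw]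
    simp
  · exact S.val_eq_zero_of_same_sign (by rw [neg_sq, he]) hz hw

/-- On `D ⊕ ℝ ξ`, for an eigenspace `D` of `φ` on `ker η`, the metric is `η ⊗ η`; membership in
`D ⊕ ℝ ξ` is expressed as orthogonality to `D`. -/
theorem val_eq_η_mul_η {x : M} {e : ℝ} (he : e ^ 2 = 1) {p q : TangentSpace 𝓘(ℝ, E) x}
    (hp : ∀ w, S.φ x w = e • w → S.g.val x p w = 0)
    (hq : ∀ w, S.φ x w = e • w → S.g.val x q w = 0) : S.g.val x p q = S.η x p * S.η x q := by
  have e0 : e ≠ 0 := by rintro rfl; norm_num at he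
  have key (u : TangentSpace 𝓘(ℝ, E) x) (hu : ∀ w, S.φ x w = e • w → S.g.val x u w = 0) :
      S.φ x (u - S.η x u • S.ξ x) = e • (u - S.η x u • S.ξ x) := by
    refine S.φ_eq_of_val he (by simp [S.η_ξ]) fun w hw ↦ ?_
    rw [map_sub, sub_apply, hu w hw, map_smul, smul_apply, S.val_ξ, S.η_eq_zero e0 hw]
    simp
  have h := S.val_eq_zero_of_same_sign he (key p hp) (key q hq)
  simp only [map_sub, map_smul, sub_apply, smul_apply, smul_eq_mul, S.val_ξ, S.η_ξ,
    S.g.symm x p (S.ξ x)] at h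
  linear_combination h

theorem contMDiffAt_ξ (x : M) : CMDiffAt ∞ (T% S.ξ) x := S.contMDiff_ξ.contMDiffAt

theorem contMDiffAt_φ {X : Π x : M, TangentSpace 𝓘(ℝ, E) x} {x : M}
    (hX : CMDiffAt ∞ (T% X) x) : CMDiffAt ∞ (T% (fun y ↦ S.φ y (X y))) x := by
  apply ContMDiffAt.clm_bundle_apply (F₁ := E) (F₂ := E)
  · exact S.contMDiff_φ.contMDiffAt
  · exact hX

/-- `X` is a field of eigenvectors of `φ` for the eigenvalue `e`, on all of `M`. -/
def IsEigenfield (e : ℝ) (X : Π x : M, TangentSpace 𝓘(ℝ, E) x) : Prop :=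
  ∀ y, S.φ y (X y) = e • X y

theorem isEigenfield_ξ : S.IsEigenfield 0 S.ξ := fun y ↦ by rw [S.φ_ξ, zero_smul]

/-- An eigenvector of `φ` extends to a smooth field of eigenvectors. -/
theorem exists_isEigenfield {x : M} {e : ℝ} (he : e ^ 2 = 1) {v : TangentSpace 𝓘(ℝ, E) x}
    (hv : S.φ x v = e • v) : ∃ X : Π x : M, TangentSpace 𝓘(ℝ, E) x,
      S.IsEigenfield e X ∧ X x = v ∧ ∀ᶠ y in nhds x, CMDiffAt ∞ (T% X) y := by
  let V : Π x : M, TangentSpace 𝓘(ℝ, E) x := extend E v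
  have hVx : V x = v := extend_apply_self (F := E) v
  refine ⟨(1 / 2 : ℝ) • ((fun y ↦ S.φ y (S.φ y (V y))) + e • fun y ↦ S.φ y (V y)), ?_, ?_, ?_⟩
  · intro y
    have h1 : S.φ y (S.φ y (S.φ y (V y))) = S.φ y (V y) := by rw [S.φ_φ, S.η_φ]; simp
    simp only [Pi.smul_apply, Pi.add_apply, map_smul, map_add, h1]
    have h2 : e • e • S.φ y (V y) = S.φ y (V y) := by rw [smul_smul, ← sq, he, one_smul]
    rw [smul_comm e, smul_add e, h2]
    module
  · simp only [Pi.smul_apply, Pi.add_apply, hVx, hv, map_smul, smul_smul, ← sq, he]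
    module
  · obtain ⟨s, hs, hsV⟩ := exists_contMDiffOn_extend (k := ∞) 𝓘(ℝ, E) E v
    filter_upwards [eventually_eventually_nhds.2 hs] with y hy
    have hV : CMDiffAt ∞ (T% V) y := hsV.contMDiffAt hy
    exact ContMDiffAt.const_smul_section (ContMDiffAt.add_section
      (S.contMDiffAt_φ (S.contMDiffAt_φ hV)) (ContMDiffAt.const_smul_section (S.contMDiffAt_φ hV)))

variable [FiniteDimensional ℝ E]

theorem val_leviCivita_ξ_sub (x : M) (v w : TangentSpace 𝓘(ℝ, E) x) :
    S.g.val x (S.g.leviCivita S.ξ x v) w - S.g.val x (S.g.leviCivita S.ξ x w) v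
      = 2 * S.g.val x v (S.φ x w) := by
  have hX := contMDiffAt_extend (k := ∞) 𝓘(ℝ, E) E v
  have hY := contMDiffAt_extend (k := ∞) 𝓘(ℝ, E) E w
  have h := S.contact x _ _ hX hY
  have hη (Y : Π x : M, TangentSpace 𝓘(ℝ, E) x) : (fun y ↦ S.η y (Y y)) = S.g.inner S.ξ Y := by
    funext y; exact (S.val_ξ y _).symm
  rw [extDerivOneForm, hη, hη, S.g.mvfderiv_inner_apply (S.contMDiffAt_ξ x) hY,
    S.g.mvfderiv_inner_apply (S.contMDiffAt_ξ x) hX, ← S.val_ξ, S.g.mlieBracket_eq hX hY,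
    map_sub] at h
  simp only [extend_apply_self] at h
  linarith

theorem η_leviCivita_ξ (x : M) (v : TangentSpace 𝓘(ℝ, E) x) :
    S.η x (S.g.leviCivita S.ξ x v) = 0 := by
  have h := S.g.mvfderiv_inner_apply (S.contMDiffAt_ξ x) (S.contMDiffAt_ξ x) v
  have h1 : S.g.inner S.ξ S.ξ = fun _ ↦ (1 : ℝ) := by
    funext y; rw [S.g.inner_apply, S.val_ξ, S.η_ξ]
  rw [h1, mvfderiv_const, S.g.symm x _ (S.ξ x), S.val_ξ] at h
  simp only [zero_apply] at h
  linarith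

theorem leviCivita_ξ_ξ (x : M) : S.g.leviCivita S.ξ x (S.ξ x) = 0 := by
  refine S.g.nondegenerate x _ fun w ↦ ?_
  have h := S.val_leviCivita_ξ_sub x (S.ξ x) w
  rw [S.val_ξ, S.η_φ, S.g.symm x _ (S.ξ x), S.val_ξ, S.η_leviCivita_ξ] at h
  linarith

/-- The self-adjoint part `v ↦ ∇_v ξ + φ v` of `∇ξ`; on a paracontact metric manifold it is
`φ ∘ h`. -/
def symmPart (x : M) : TangentSpace 𝓘(ℝ, E) x →L[ℝ] TangentSpace 𝓘(ℝ, E) x :=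
  S.g.leviCivita S.ξ x + S.φ x

theorem leviCivita_ξ_eq (x : M) (v : TangentSpace 𝓘(ℝ, E) x) :
    S.g.leviCivita S.ξ x v = S.symmPart x v - S.φ x v := by
  simp [symmPart]

theorem symmPart_ξ (x : M) : S.symmPart x (S.ξ x) = 0 := by
  simp [symmPart, S.leviCivita_ξ_ξ, S.φ_ξ]

theorem η_symmPart (x : M) (v : TangentSpace 𝓘(ℝ, E) x) : S.η x (S.symmPart x v) = 0 := by
  simp [symmPart, S.η_leviCivita_ξ, S.η_φ]

theorem val_symmPart_comm (x : M) (v w : TangentSpace 𝓘(ℝ, E) x) :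
    S.g.val x (S.symmPart x v) w = S.g.val x (S.symmPart x w) v := by
  have h := S.val_leviCivita_ξ_sub x v w
  have h1 := S.val_φ_left x v w
  have h2 := S.g.symm x v (S.φ x w)
  simp only [symmPart, add_apply, map_add]
  linarith

theorem contMDiffAt_symmPart {X : Π x : M, TangentSpace 𝓘(ℝ, E) x} {x : M}
    (hX : CMDiffAt ∞ (T% X) x) : CMDiffAt ∞ (T% (fun y ↦ S.symmPart y (X y))) x :=
  ContMDiffAt.add_section (S.g.contMDiffAt_leviCivita hX (S.contMDiffAt_ξ x)) (S.contMDiffAt_φ hX)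

end ParacontactMetricStructure
end Paracontact

/-! ### Paracontact metric structures of constant curvature -/

namespace Paracontact

/-- The curvature tensor has the form `R(X, Y) Z = c (g(Y, Z) X - g(X, Z) Y)`. -/
def PseudoRiemannianMetric.HasConstantCurvatureTensor {E : Type*} [NormedAddCommGroup E]
    [NormedSpace ℝ E] [FiniteDimensional ℝ E] {M : Type*} [TopologicalSpace M] [ChartedSpace E M]
    [IsManifold 𝓘(ℝ, E) ∞ M] (g : PseudoRiemannianMetric E M) (c : ℝ) : Prop :=
  ∀ (x : M) (X Y Z : Π x : M, TangentSpace 𝓘(ℝ, E) x), CMDiffAt ∞ (T% X) x →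
    CMDiffAt ∞ (T% Y) x → CMDiffAt ∞ (T% Z) x →
      g.curvature X Y Z x = c • (g.val x (Y x) (Z x) • X x - g.val x (X x) (Z x) • Y x)

namespace ParacontactMetricStructure

variable {E : Type*} [NormedAddCommGroup E] [NormedSpace ℝ E] [FiniteDimensional ℝ E]
  {M : Type*} [TopologicalSpace M] [ChartedSpace E M] [IsManifold 𝓘(ℝ, E) ∞ M]
  {n : ℕ} (S : ParacontactMetricStructure E M n) {c : ℝ} {x : M}
  {X Y Z W : Π x : M, TangentSpace 𝓘(ℝ, E) x}

/-- The derivative of `g(∇_Y ξ, Z) - g(∇_Z ξ, Y) = 2 g(Y, φ Z)` along `X`, for eigenfields `Y`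
and `Z` of `φ`. -/
theorem val_leviCivita_leviCivita_ξ {e₂ e₃ : ℝ} (hY : CMDiffAt ∞ (T% Y) x)
    (hZ : CMDiffAt ∞ (T% Z) x)
    (sY : S.IsEigenfield e₂ Y) (sZ : S.IsEigenfield e₃ Z) (v : TangentSpace 𝓘(ℝ, E) x) :
    S.g.val x (S.g.leviCivita (fun y ↦ S.g.leviCivita S.ξ y (Y y)) x v) (Z x)
      - S.g.val x (S.g.leviCivita (fun y ↦ S.g.leviCivita S.ξ y (Z y)) x v) (Y x)
      + S.g.val x (S.g.leviCivita S.ξ x (S.g.leviCivita Z x v)) (Y x)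
      - S.g.val x (S.g.leviCivita S.ξ x (S.g.leviCivita Y x v)) (Z x)
      = 2 * (e₂ + e₃) * S.g.val x (Y x) (S.g.leviCivita Z x v) := by
  have hAY := S.g.contMDiffAt_leviCivita hY (S.contMDiffAt_ξ x)
  have hAZ := S.g.contMDiffAt_leviCivita hZ (S.contMDiffAt_ξ x)
  have e : S.g.inner (fun y ↦ S.g.leviCivita S.ξ y (Y y)) Z
      = S.g.inner (fun y ↦ S.g.leviCivita S.ξ y (Z y)) Y + fun y ↦ (2 * e₃) * S.g.inner Y Z y := by
    funext y
    have := S.val_leviCivita_ξ_sub y (Y y) (Z y)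
    rw [sZ y, map_smul, smul_eq_mul] at this
    simp only [PseudoRiemannianMetric.inner_apply, Pi.add_apply]
    linarith
  have e1 := S.g.mvfderiv_inner_apply hAY hZ v
  have hd := (S.g.contMDiffAt_inner hY hZ).mdifferentiableAt (n := ∞) (by simp)
  have hc : mvfderiv 𝓘(ℝ, E) (fun y ↦ (2 * e₃) * S.g.inner Y Z y) x v
      = (2 * e₃) * mvfderiv 𝓘(ℝ, E) (S.g.inner Y Z) x v := by
    have := mvfderiv_mul (I := 𝓘(ℝ, E)) (f := fun _ : M ↦ 2 * e₃) mdifferentiableAt_const hd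
    have h2 := congrArg (fun l ↦ l v) this
    simpa [mvfderiv_const] using! h2
  have hdc : MDiffAt (fun y ↦ (2 * e₃) * S.g.inner Y Z y) x :=
    MDifferentiableAt.mul mdifferentiableAt_const hd
  rw [e, mvfderiv_add ((S.g.contMDiffAt_inner hAZ hY).mdifferentiableAt (by simp)) hdc, add_apply,
    hc, S.g.mvfderiv_inner_apply hAZ hY, S.g.mvfderiv_inner_apply hY hZ] at e1
  have e2 := S.val_leviCivita_ξ_sub x (Y x) (S.g.leviCivita Z x v)
  have e3 := S.val_leviCivita_ξ_sub x (Z x) (S.g.leviCivita Y x v)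
  have e4 := S.val_φ_left x (Y x) (S.g.leviCivita Z x v)
  have e5 := S.val_φ_left x (Z x) (S.g.leviCivita Y x v)
  rw [sY x, map_smul, smul_apply, smul_eq_mul] at e4
  rw [sZ x, map_smul, smul_apply, smul_eq_mul, S.g.symm x (Z x)] at e5
  linarith

/-- `R(X, Y) ξ` in terms of `∇ξ`: the difference of `(∇_X (∇ξ)) Y` and `(∇_Y (∇ξ)) X`. -/
theorem curvature_ξ_eq (hX : CMDiffAt ∞ (T% X) x) (hY : CMDiffAt ∞ (T% Y) x)
    (w : TangentSpace 𝓘(ℝ, E) x) :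
    S.g.val x (S.g.curvature X Y S.ξ x) w
      = S.g.val x (S.g.leviCivita (fun y ↦ S.g.leviCivita S.ξ y (Y y)) x (X x)) w
      - S.g.val x (S.g.leviCivita (fun y ↦ S.g.leviCivita S.ξ y (X y)) x (Y x)) w
      - (S.g.val x (S.g.leviCivita S.ξ x (S.g.leviCivita Y x (X x))) w
        - S.g.val x (S.g.leviCivita S.ξ x (S.g.leviCivita X x (Y x))) w) := by
  simp only [PseudoRiemannianMetric.curvature, S.g.mlieBracket_eq hX hY, map_sub, sub_apply]

variable {S}

/-- The closedness of `dη`, evaluated on eigenfields of `φ`. It is obtained from the first Bianchi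
identity, applied to `ξ`. -/
theorem closedness {e₁ e₂ e₃ : ℝ} (hX : CMDiffAt ∞ (T% X) x) (hY : CMDiffAt ∞ (T% Y) x)
    (hZ : CMDiffAt ∞ (T% Z) x) (sX : S.IsEigenfield e₁ X) (sY : S.IsEigenfield e₂ Y)
    (sZ : S.IsEigenfield e₃ Z) :
    (e₂ + e₃) * S.g.val x (Y x) (S.g.leviCivita Z x (X x))
      + (e₃ + e₁) * S.g.val x (Z x) (S.g.leviCivita X x (Y x))
      + (e₁ + e₂) * S.g.val x (X x) (S.g.leviCivita Y x (Z x)) = 0 := by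
  have h1 := S.val_leviCivita_leviCivita_ξ hY hZ sY sZ (X x)
  have h2 := S.val_leviCivita_leviCivita_ξ hZ hX sZ sX (Y x)
  have h3 := S.val_leviCivita_leviCivita_ξ hX hY sX sY (Z x)
  have hξ := S.contMDiffAt_ξ x
  have r1 := S.curvature_ξ_eq hX hY (Z x)
  have r2 := S.curvature_ξ_eq hY hZ (X x)
  have r3 := S.curvature_ξ_eq hZ hX (Y x)
  have s1 := S.g.curvature_skew_right hX hY hξ hZ
  have s2 := S.g.curvature_skew_right hY hZ hξ hX
  have s3 := S.g.curvature_skew_right hZ hX hξ hY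
  have b := congrArg (fun u ↦ S.g.val x u (S.ξ x)) (S.g.curvature_bianchi hX hY hZ)
  simp only [map_add, add_apply, map_zero, zero_apply] at b
  linarith

/-- `∇_X` preserves the eigendistributions of `φ`, up to `ξ`, in the directions of the opposite
eigendistribution. -/
theorem val_leviCivita_of_opposite {e : ℝ} (he : e ^ 2 = 1) (hX : CMDiffAt ∞ (T% X) x)
    (hY : CMDiffAt ∞ (T% Y) x) (hZ : CMDiffAt ∞ (T% Z) x) (sX : S.IsEigenfield (-e) X)
    (sY : S.IsEigenfield e Y) (sZ : S.IsEigenfield e Z) :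
    S.g.val x (S.g.leviCivita Z x (X x)) (Y x) = 0 := by
  have h := closedness hX hY hZ sX sY sZ
  rw [S.g.symm]
  have e0 : e ≠ 0 := by rintro rfl; norm_num at he
  have : 2 * e * S.g.val x (Y x) (S.g.leviCivita Z x (X x)) = 0 := by linear_combination h
  simpa [e0] using this

theorem val_leviCivita_ξ_left (hY : CMDiffAt ∞ (T% Y) x) (hη : ∀ y, S.η y (Y y) = 0)
    (v : TangentSpace 𝓘(ℝ, E) x) :
    S.η x (S.g.leviCivita Y x v) = -S.g.val x (S.g.leviCivita S.ξ x v) (Y x) := by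
  have h := S.g.mvfderiv_inner_apply (S.contMDiffAt_ξ x) hY v
  have h1 : S.g.inner S.ξ Y = fun _ ↦ (0 : ℝ) := by
    funext y; rw [S.g.inner_apply, S.val_ξ, hη]
  rw [h1, mvfderiv_const, S.val_ξ] at h
  simp only [zero_apply] at h
  linarith

/-- `∇_ξ` preserves the eigendistributions of `φ`. -/
theorem val_leviCivita_ξ_direction {e : ℝ} (he : e ^ 2 = 1) (hY : CMDiffAt ∞ (T% Y) x)
    (hZ : CMDiffAt ∞ (T% Z) x) (sY : S.IsEigenfield e Y) (sZ : S.IsEigenfield e Z) :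
    S.g.val x (S.g.leviCivita Z x (S.ξ x)) (Y x) = 0 := by
  have e0 : e ≠ 0 := by rintro rfl; norm_num at he
  have h := closedness (S.contMDiffAt_ξ x) hY hZ S.isEigenfield_ξ sY sZ
  rw [S.val_ξ, val_leviCivita_ξ_left hY (fun y ↦ S.η_eq_zero e0 (sY y)), S.g.symm x (Y x),
    S.g.symm x (Z x)] at h
  have h2 := S.val_leviCivita_ξ_sub x (Y x) (Z x)
  rw [sZ x, map_smul, S.val_eq_zero_of_same_sign he (sY x) (sZ x), smul_zero] at h2
  have : 2 * e * S.g.val x (S.g.leviCivita Z x (S.ξ x)) (Y x) = 0 := by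
    linear_combination h - e * h2
  simpa [e0] using this

/-- `∇ξ + φ` exchanges the eigenspaces of `φ` on `ker η`. -/
theorem φ_symmPart {e : ℝ} (he : e ^ 2 = 1) {v : TangentSpace 𝓘(ℝ, E) x} (hv : S.φ x v = e • v) :
    S.φ x (S.symmPart x v) = (-e) • S.symmPart x v := by
  have e0 : e ≠ 0 := by rintro rfl; norm_num at he
  have he' : (-e) ^ 2 = 1 := by rw [neg_sq, he]
  refine S.φ_eq_of_val he' (S.η_symmPart x v) fun w hw ↦ ?_
  obtain ⟨Y, sY, rfl, hY⟩ := S.exists_isEigenfield he hv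
  obtain ⟨Z, sZ, rfl, hZ⟩ := S.exists_isEigenfield he' hw
  have h := closedness (S.contMDiffAt_ξ x) hY.self_of_nhds hZ.self_of_nhds S.isEigenfield_ξ sY sZ
  rw [S.val_ξ, val_leviCivita_ξ_left hY.self_of_nhds (fun y ↦ S.η_eq_zero e0 (sY y)),
    S.g.symm x (Z x)] at h
  have h2 := S.val_leviCivita_ξ_sub x (Y x) (Z x)
  rw [sZ x, map_smul, smul_eq_mul] at h2
  have h3 : e * (S.g.val x (S.g.leviCivita S.ξ x (Y x)) (Z x) + e * S.g.val x (Y x) (Z x)) = 0 := by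
    linear_combination (-1 / 2 : ℝ) * h + e * (1 / 2) * h2
  rw [symmPart, add_apply, map_add, add_apply, sY x, map_smul, smul_apply, smul_eq_mul]
  exact (mul_eq_zero.1 h3).resolve_left e0

theorem isEigenfield_symmPart {e : ℝ} (he : e ^ 2 = 1) (sX : S.IsEigenfield e X) :
    S.IsEigenfield (-e) (fun y ↦ S.symmPart y (X y)) :=
  fun y ↦ φ_symmPart he (sX y)

/-- The covariant derivative of the field `∇_X ξ`, for an eigenfield `X` of `φ`. -/
theorem leviCivita_leviCivita_ξ {e : ℝ} (hX : CMDiffAt ∞ (T% X) x)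
    (sX : S.IsEigenfield e X) (v : TangentSpace 𝓘(ℝ, E) x) :
    S.g.leviCivita (fun y ↦ S.g.leviCivita S.ξ y (X y)) x v
      = S.g.leviCivita (fun y ↦ S.symmPart y (X y)) x v - e • S.g.leviCivita X x v := by
  have h : (fun y ↦ S.g.leviCivita S.ξ y (X y)) = (fun y ↦ S.symmPart y (X y)) + (-e) • X := by
    funext y
    rw [S.leviCivita_ξ_eq, sX y, Pi.add_apply, Pi.smul_apply, neg_smul, sub_eq_add_neg]
  rw [h, S.g.leviCivita_add (S.contMDiffAt_symmPart hX) (ContMDiffAt.const_smul_section hX),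
    S.g.leviCivita_const_smul _ hX]
  simp [sub_eq_add_neg]

/-- The adjoint of `∇ξ = B - φ` is `B + φ`, evaluated here on an eigenvector of `φ`. -/
theorem val_leviCivita_ξ_of_sign {e : ℝ} {z : TangentSpace 𝓘(ℝ, E) x} (hz : S.φ x z = (-e) • z)
    (u : TangentSpace 𝓘(ℝ, E) x) :
    S.g.val x (S.g.leviCivita S.ξ x u) z = S.g.val x (S.symmPart x z) u - e * S.g.val x u z := by
  rw [S.leviCivita_ξ_eq, map_sub, sub_apply, S.val_symmPart_comm, S.val_φ_left, hz, map_smul,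
    smul_eq_mul]
  ring

/-- The Jacobi operator `R(·, ξ) ξ` determines the square of `∇ξ + φ`. -/
theorem val_symmPart_symmPart (hR : S.g.HasConstantCurvatureTensor c) {e : ℝ} (he : e ^ 2 = 1)
    {v w : TangentSpace 𝓘(ℝ, E) x} (hv : S.φ x v = e • v) (hw : S.φ x w = (-e) • w) :
    S.g.val x (S.symmPart x v) (S.symmPart x w) = -(1 + c) * S.g.val x v w := by
  have e0 : e ≠ 0 := by rintro rfl; norm_num at he
  have he' : (-e) ^ 2 = 1 := by rw [neg_sq, he]
  obtain ⟨X, sX, rfl, hX⟩ := S.exists_isEigenfield he hv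
  obtain ⟨Z, sZ, rfl, hZ⟩ := S.exists_isEigenfield he' hw
  replace hX := hX.self_of_nhds
  replace hZ := hZ.self_of_nhds
  have hBX := S.contMDiffAt_symmPart hX
  have hBZ := S.contMDiffAt_symmPart hZ
  have sBX := isEigenfield_symmPart he sX
  have sBZ := isEigenfield_symmPart he' sZ
  rw [neg_neg] at sBZ
  have hξ := S.contMDiffAt_ξ x
  have r := S.curvature_ξ_eq hX hξ (Z x)
  have h0 : S.g.leviCivita (fun y ↦ S.g.leviCivita S.ξ y (S.ξ y)) x = 0 := by
    have : (fun y ↦ S.g.leviCivita S.ξ y (S.ξ y)) = (0 : Π y : M, TangentSpace 𝓘(ℝ, E) y) := by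
      funext y; exact S.leviCivita_ξ_ξ y
    rw [this]
    exact congrFun S.g.leviCivita.zero x
  rw [hR x X S.ξ S.ξ hX hξ hξ, h0, leviCivita_leviCivita_ξ hX sX,
    val_leviCivita_ξ_of_sign hw (S.g.leviCivita S.ξ x (X x)),
    val_leviCivita_ξ_of_sign hw (S.g.leviCivita X x (S.ξ x)), S.val_ξ, S.η_ξ,
    S.g.symm x (X x) (S.ξ x), S.val_ξ, S.η_eq_zero e0 hv, S.leviCivita_ξ_eq, hv] at r
  have f1 := val_leviCivita_ξ_direction he' hZ hBX sZ sBX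
  have f2 := val_leviCivita_ξ_direction he hBZ hX sBZ sX
  have f3 := S.val_eq_zero_of_same_sign he (sBZ x) hv
  have f4 := S.val_eq_zero_of_same_sign he' (sBX x) hw
  rw [S.g.symm] at f2
  simp only [map_sub, map_smul, sub_apply, smul_apply, smul_eq_mul, f1, f2, f3, f4,
    S.g.symm x (S.symmPart x (Z x)) (S.symmPart x (X x)), zero_apply, map_zero] at r
  linear_combination r - S.g.val x (X x) (Z x) * he

/-- `B² = -(1 + c)` on `ker η`, for `B = ∇ξ + φ`. -/
theorem symmPart_symmPart (hR : S.g.HasConstantCurvatureTensor c) {e : ℝ} (he : e ^ 2 = 1)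
    {v : TangentSpace 𝓘(ℝ, E) x} (hv : S.φ x v = e • v) :
    S.symmPart x (S.symmPart x v) = (-(1 + c)) • v := by
  have e0 : e ≠ 0 := by rintro rfl; norm_num at he
  have he' : (-e) ^ 2 = 1 := by rw [neg_sq, he]
  have hBB := φ_symmPart he' (φ_symmPart he hv)
  rw [neg_neg] at hBB
  rw [← sub_eq_zero]
  refine S.eq_zero_of_val ?_ fun f w hf hw ↦ ?_
  · rw [map_sub, map_smul, S.η_symmPart, S.η_eq_zero e0 hv]; simp
  rcases (sq_eq_sq_iff_eq_or_eq_neg.1 (hf.trans he.symm)) with rfl | rfl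
  · rw [map_sub, sub_apply, S.val_eq_zero_of_same_sign he hBB hw, map_smul, smul_apply,
      S.val_eq_zero_of_same_sign he hv hw]
    simp
  · rw [map_sub, sub_apply, S.val_symmPart_comm, S.g.symm, val_symmPart_symmPart hR he hv hw,
      map_smul, smul_apply, smul_eq_mul, sub_self]

/-- If `c ≠ -1`, the bracket `[X, Y] = ∇_X Y - ∇_Y X` of two fields in an eigendistribution of `φ` on
`ker η` is orthogonal to that eigendistribution: the Codazzi equation for `∇ξ` shows that it is
orthogonal to the image of the opposite one under `∇ξ + φ`, which is invertible on `ker η`. -/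
theorem val_leviCivita_swap (hR : S.g.HasConstantCurvatureTensor c) (hc : c ≠ -1) {e : ℝ}
    (he : e ^ 2 = 1) (hX : CMDiffAt ∞ (T% X) x) (hY : CMDiffAt ∞ (T% Y) x)
    (sX : S.IsEigenfield e X) (sY : S.IsEigenfield e Y) {w : TangentSpace 𝓘(ℝ, E) x}
    (hw : S.φ x w = e • w) :
    S.g.val x (S.g.leviCivita Y x (X x)) w = S.g.val x (S.g.leviCivita X x (Y x)) w := by
  have e0 : e ≠ 0 := by rintro rfl; norm_num at he
  have he' : (-e) ^ 2 = 1 := by rw [neg_sq, he]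
  have hc' : -(1 + c) ≠ 0 := fun h ↦ hc (by linarith)
  have hz' := φ_symmPart he hw
  obtain ⟨Z, sZ, hZw, hZ⟩ := S.exists_isEigenfield he' hz'
  replace hZ := hZ.self_of_nhds
  have hBX := S.contMDiffAt_symmPart hX
  have hBY := S.contMDiffAt_symmPart hY
  have sBX := isEigenfield_symmPart he sX
  have sBY := isEigenfield_symmPart he sY
  have r := S.curvature_ξ_eq hX hY (Z x)
  rw [hR x X Y S.ξ hX hY (S.contMDiffAt_ξ x), S.g.symm x (Y x) (S.ξ x), S.val_ξ,
    S.g.symm x (X x) (S.ξ x), S.val_ξ, S.η_eq_zero e0 (sX x), S.η_eq_zero e0 (sY x),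
    leviCivita_leviCivita_ξ hX sX, leviCivita_leviCivita_ξ hY sY,
    val_leviCivita_ξ_of_sign (sZ x), val_leviCivita_ξ_of_sign (sZ x)] at r
  have hopp {U V : Π x : M, TangentSpace 𝓘(ℝ, E) x} (hU : CMDiffAt ∞ (T% U) x)
      (hV : CMDiffAt ∞ (T% V) x) (sU : S.IsEigenfield e U) (sV : S.IsEigenfield (-e) V) :
      S.g.val x (S.g.leviCivita V x (U x)) (Z x) = 0 :=
    val_leviCivita_of_opposite he' hU hZ hV (by rwa [neg_neg]) sZ sV
  have f1 := hopp hX hBY sX sBY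
  have f2 := hopp hY hBX sY sBX
  rw [hZw, symmPart_symmPart hR he hw, ← hZw] at r
  simp only [map_sub, map_smul, sub_apply, smul_apply, smul_eq_mul, f1, f2, zero_smul, sub_self,
    smul_zero, map_zero, zero_apply] at r
  rw [S.g.symm x w, S.g.symm x w] at r
  have : -(1 + c) * (S.g.val x (S.g.leviCivita Y x (X x)) w
      - S.g.val x (S.g.leviCivita X x (Y x)) w) = 0 := by linear_combination r
  exact sub_eq_zero.1 ((mul_eq_zero.1 this).resolve_left hc')

theorem val_leviCivita_skew {e : ℝ} (he : e ^ 2 = 1) (hY : CMDiffAt ∞ (T% Y) x)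
    (hZ : CMDiffAt ∞ (T% Z) x) (sY : S.IsEigenfield e Y) (sZ : S.IsEigenfield e Z)
    (v : TangentSpace 𝓘(ℝ, E) x) :
    S.g.val x (S.g.leviCivita Y x v) (Z x) = -S.g.val x (S.g.leviCivita Z x v) (Y x) := by
  have h := S.g.mvfderiv_inner_apply hY hZ v
  have h1 : S.g.inner Y Z = fun _ ↦ (0 : ℝ) := by
    funext y; exact S.val_eq_zero_of_same_sign he (sY y) (sZ y)
  rw [h1, mvfderiv_const, S.g.symm x (Y x)] at h
  simp only [zero_apply] at h
  linarith

/-- If `c ≠ -1`, the covariant derivatives of a field in an eigendistribution of `φ` on `ker η`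
stay, in all directions, in the sum of that eigendistribution and of the line spanned by `ξ`. -/
theorem val_leviCivita_eq_zero (hR : S.g.HasConstantCurvatureTensor c) (hc : c ≠ -1) {e : ℝ}
    (he : e ^ 2 = 1) (hY : CMDiffAt ∞ (T% Y) x) (hZ : CMDiffAt ∞ (T% Z) x)
    (sY : S.IsEigenfield e Y) (sZ : S.IsEigenfield e Z) (v : TangentSpace 𝓘(ℝ, E) x) :
    S.g.val x (S.g.leviCivita Y x v) (Z x) = 0 := by
  refine S.induction_decomp (P := fun v ↦ S.g.val x (S.g.leviCivita Y x v) (Z x) = 0) ?_ ?_ ?_ v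
  · intro v w hv hw
    rw [map_add, map_add, add_apply, hv, hw, add_zero]
  · intro f v hf hv
    obtain ⟨X, sX, rfl, hX⟩ := S.exists_isEigenfield hf hv
    replace hX := hX.self_of_nhds
    rcases (sq_eq_sq_iff_eq_or_eq_neg.1 (hf.trans he.symm)) with rfl | rfl
    · -- a trilinear form that is symmetric in two and skew in two arguments vanishes
      have a1 := val_leviCivita_swap hR hc he hX hY sX sY (sZ x)
      have a2 := val_leviCivita_skew he hX hZ sX sZ (Y x)
      have a3 := val_leviCivita_swap hR hc he hY hZ sY sZ (sX x)
      have a4 := val_leviCivita_skew he hY hX sY sX (Z x)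
      have a5 := val_leviCivita_swap hR hc he hZ hX sZ sX (sY x)
      have a6 := val_leviCivita_skew he hZ hY sZ sY (X x)
      linarith
    · exact val_leviCivita_of_opposite he hX hZ hY sX sZ sY
  · intro t
    rw [map_smul, map_smul, smul_apply, val_leviCivita_ξ_direction he hZ hY sZ sY, smul_zero]

/-- If `c ≠ -1`, the bilinear form `g((∇ξ + φ) ·, ·)` has rank at most one on each eigenspace of
`φ` on `ker η`: this is the Gauss equation for the eigendistribution. -/
theorem val_symmPart_mul (hR : S.g.HasConstantCurvatureTensor c) (hc : c ≠ -1) {e : ℝ}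
    (he : e ^ 2 = 1) {v₁ v₂ v₃ v₄ : TangentSpace 𝓘(ℝ, E) x} (h₁ : S.φ x v₁ = e • v₁)
    (h₂ : S.φ x v₂ = e • v₂) (h₃ : S.φ x v₃ = e • v₃) (h₄ : S.φ x v₄ = e • v₄) :
    S.g.val x (S.symmPart x v₁) v₃ * S.g.val x (S.symmPart x v₂) v₄
      = S.g.val x (S.symmPart x v₂) v₃ * S.g.val x (S.symmPart x v₁) v₄ := by
  have e0 : e ≠ 0 := by rintro rfl; norm_num at he
  obtain ⟨X, sX, rfl, hX⟩ := S.exists_isEigenfield he h₁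
  obtain ⟨Y, sY, rfl, hY⟩ := S.exists_isEigenfield he h₂
  obtain ⟨Z, sZ, rfl, hZ⟩ := S.exists_isEigenfield he h₃
  obtain ⟨W, sW, rfl, hW⟩ := S.exists_isEigenfield he h₄
  have hA (v : TangentSpace 𝓘(ℝ, E) x) (hv : S.φ x v = e • v) {U : Π x : M, TangentSpace 𝓘(ℝ, E) x}
      (sU : S.IsEigenfield e U) :
      S.g.val x (S.g.leviCivita S.ξ x v) (U x) = S.g.val x (S.symmPart x v) (U x) := by
    rw [S.leviCivita_ξ_eq, map_sub, sub_apply, hv, map_smul, smul_apply,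
      S.val_eq_zero_of_same_sign he hv (sU x)]
    simp
  -- `g(∇_U ∇_V Z, W) = -g(∇_V Z, ∇_U W)` since `g(∇_V Z, W)` vanishes near `x`
  have key {U V : Π x : M, TangentSpace 𝓘(ℝ, E) x} (hU : CMDiffAt ∞ (T% U) x)
      (hV : CMDiffAt ∞ (T% V) x) (sU : S.IsEigenfield e U) (sV : S.IsEigenfield e V) :
      S.g.val x (S.g.leviCivita (fun y ↦ S.g.leviCivita Z y (V y)) x (U x)) (W x)
        = -(S.g.val x (S.symmPart x (V x)) (Z x) * S.g.val x (S.symmPart x (U x)) (W x)) := by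
    have hd := S.g.mvfderiv_inner_apply (S.g.contMDiffAt_leviCivita hV hZ.self_of_nhds)
      hW.self_of_nhds (U x)
    have hev : S.g.inner (fun y ↦ S.g.leviCivita Z y (V y)) W =ᶠ[nhds x] fun _ ↦ (0 : ℝ) := by
      filter_upwards [hZ, hW] with y hZy hWy
      exact val_leviCivita_eq_zero hR hc he hZy hWy sZ sW (V y)
    have horth {T : Π x : M, TangentSpace 𝓘(ℝ, E) x} (hT : CMDiffAt ∞ (T% T) x)
        (sT : S.IsEigenfield e T) (v w : TangentSpace 𝓘(ℝ, E) x) (hw : S.φ x w = e • w) :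
        S.g.val x (S.g.leviCivita T x v) w = 0 := by
      obtain ⟨T', sT', rfl, hT'⟩ := S.exists_isEigenfield he hw
      exact val_leviCivita_eq_zero hR hc he hT hT'.self_of_nhds sT sT' v
    rw [mvfderiv_congr hev, mvfderiv_const, S.val_eq_η_mul_η he (horth hZ.self_of_nhds sZ (V x))
      (horth hW.self_of_nhds sW (U x)),
      val_leviCivita_ξ_left hZ.self_of_nhds (fun y ↦ S.η_eq_zero e0 (sZ y)),
      val_leviCivita_ξ_left hW.self_of_nhds (fun y ↦ S.η_eq_zero e0 (sW y)),
      hA _ (sV x) sZ, hA _ (sU x) sW] at hd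
    simp only [zero_apply] at hd
    linarith
  have r := congrArg (fun u ↦ S.g.val x u (W x))
    (hR x X Y Z hX.self_of_nhds hY.self_of_nhds hZ.self_of_nhds)
  simp only [PseudoRiemannianMetric.curvature] at r
  rw [map_sub, map_sub, sub_apply, sub_apply, key hX.self_of_nhds hY.self_of_nhds sX sY,
    key hY.self_of_nhds hX.self_of_nhds sY sX,
    val_leviCivita_eq_zero hR hc he hZ.self_of_nhds hW.self_of_nhds sZ sW,
    S.val_eq_zero_of_same_sign he (sY x) (sZ x), S.val_eq_zero_of_same_sign he (sX x) (sZ x)] at r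
  simp only [zero_smul, sub_self, smul_zero, map_zero, zero_apply] at r
  linarith

end ParacontactMetricStructure
end Paracontact

/-! ### The tensor `h` and the conclusion -/

namespace Paracontact

section NormSq

variable {E : Type*} [NormedAddCommGroup E] [NormedSpace ℝ E]
  {M : Type*} [TopologicalSpace M] [ChartedSpace E M] [IsManifold 𝓘(ℝ, E) ∞ M]

open scoped Matrix in
/-- The squared norm of a self-adjoint endomorphism `T` is the trace of `T ∘ T`; only the case
`T ∘ T = 0` is needed. -/
theorem PseudoRiemannianMetric.normSq_eq_zero (g : PseudoRiemannianMetric E M) (x : M)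
    {ι : Type*} [Fintype ι] [DecidableEq ι] (b : Module.Basis ι ℝ (TangentSpace 𝓘(ℝ, E) x))
    (T : TangentSpace 𝓘(ℝ, E) x →L[ℝ] TangentSpace 𝓘(ℝ, E) x)
    (hsymm : ∀ v w, g.val x (T v) w = g.val x (T w) v) (hT : ∀ v, T (T v) = 0) :
    g.normSq x b T = 0 := by
  let G : Matrix ι ι ℝ := Matrix.of fun i j ↦ g.val x (b i) (b j)
  let t : Matrix ι ι ℝ := Matrix.of fun i j ↦ g.val x (T (b i)) (b j)
  let H : Matrix ι ι ℝ := Matrix.of fun i k ↦ b.repr (T (b i)) k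
  have hG : IsUnit G.det := by
    rw [isUnit_iff_ne_zero]
    intro h0
    obtain ⟨v, hv, hGv⟩ := Matrix.exists_mulVec_eq_zero_iff.2 h0
    have hu : ∑ j, v j • b j = 0 := by
      refine g.nondegenerate x _ fun w ↦ ?_
      have hw (i) : g.val x (∑ j, v j • b j) (b i) = 0 := by
        have := congrFun hGv i
        simp only [Matrix.mulVec, dotProduct, G, Matrix.of_apply, Pi.zero_apply] at this
        rw [g.symm, map_sum, ← this]
        exact Finset.sum_congr rfl fun j _ ↦ by rw [map_smul, smul_eq_mul, mul_comm]
      have : ((g.val x (∑ j, v j • b j) : TangentSpace 𝓘(ℝ, E) x →L[ℝ] ℝ) :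
          TangentSpace 𝓘(ℝ, E) x →ₗ[ℝ] ℝ) = 0 := b.ext fun i ↦ by simpa using! hw i
      exact congrArg (fun l ↦ l w) this
    exact hv (funext fun j ↦ Fintype.linearIndependent_iff.1 b.linearIndependent v hu j)
  have hHG : t = H * G := by
    ext i j
    simp only [t, H, G, Matrix.mul_apply, Matrix.of_apply]
    have h := congrArg (fun u ↦ g.val x u (b j)) (b.sum_repr (T (b i)))
    simp only [map_sum, map_smul, sum_apply, smul_apply, smul_eq_mul] at h
    exact h.symm
  have htt : tᵀ = t := by
    ext i j
    exact hsymm _ _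
  have hHt : H * t = 0 := by
    ext i j
    have h2 : T (∑ k, b.repr (T (b i)) k • b k) = 0 := by rw [b.sum_repr, hT]
    simp only [map_sum, map_smul] at h2
    have h3 := congrArg (fun u ↦ g.val x u (b j)) h2
    simpa [H, t, Matrix.mul_apply] using h3
  have key : t * G⁻¹ * tᵀ = 0 := by
    rw [htt, hHG, Matrix.mul_nonsing_inv_cancel_right _ _ hG, ← hHG, hHt]
  have hsum : g.normSq x b T = ∑ i, ∑ r, G⁻¹ i r * (t * G⁻¹ * tᵀ) i r := by
    change ∑ i, ∑ j, ∑ r, ∑ s, G⁻¹ i r * G⁻¹ j s * t i j * t r s = _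
    refine Finset.sum_congr rfl fun i _ ↦ ?_
    rw [Finset.sum_comm]
    refine Finset.sum_congr rfl fun r _ ↦ ?_
    simp only [Matrix.mul_apply, Matrix.transpose_apply, Finset.sum_mul, Finset.mul_sum]
    rw [Finset.sum_comm]
    exact Finset.sum_congr rfl fun s _ ↦ Finset.sum_congr rfl fun j _ ↦ by ring
  rw [hsum, key]
  simp

end NormSq

namespace ParacontactMetricStructure

variable {E : Type*} [NormedAddCommGroup E] [NormedSpace ℝ E] [FiniteDimensional ℝ E]
  {M : Type*} [TopologicalSpace M] [ChartedSpace E M] [IsManifold 𝓘(ℝ, E) ∞ M]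
  {n : ℕ} {S : ParacontactMetricStructure E M n} {c : ℝ} {x : M}
  {X : Π x : M, TangentSpace 𝓘(ℝ, E) x}

theorem lieDerivφ_of_isEigenfield {e : ℝ} (hX : CMDiffAt ∞ (T% X) x) (sX : S.IsEigenfield e X) :
    S.lieDerivφ X x = e • mlieBracket 𝓘(ℝ, E) S.ξ X x - S.φ x (mlieBracket 𝓘(ℝ, E) S.ξ X x) := by
  have h : (fun y ↦ S.φ y (X y)) = e • X := funext sX
  rw [AlmostParacontactStructure.lieDerivφ, h,
    mlieBracket_const_smul_right (mdifferentiableAt_of_smooth hX)]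

/-- On a paracontact metric manifold, `∇ξ = -φ + φ h`. -/
theorem h_eq (v : TangentSpace 𝓘(ℝ, E) x) : S.h x v = S.φ x (S.symmPart x v) := by
  refine S.induction_decomp (P := fun v ↦ S.h x v = S.φ x (S.symmPart x v)) ?_ ?_ ?_ v
  · intro v w hv hw
    simp only [map_add, hv, hw]
  · intro e v he hv
    have e0 : e ≠ 0 := by rintro rfl; norm_num at he
    obtain ⟨X, sX, rfl, hX⟩ := S.exists_isEigenfield he hv
    replace hX := hX.self_of_nhds
    rw [S.h_apply (mdifferentiableAt_of_smooth hX), lieDerivφ_of_isEigenfield hX sX,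
      S.g.mlieBracket_eq (S.contMDiffAt_ξ x) hX]
    have hφ : S.φ x (S.g.leviCivita X x (S.ξ x)) = e • S.g.leviCivita X x (S.ξ x) := by
      refine S.φ_eq_of_val he ?_ fun w hw ↦ ?_
      · rw [val_leviCivita_ξ_left hX (fun y ↦ S.η_eq_zero e0 (sX y)), S.leviCivita_ξ_ξ]
        simp
      · obtain ⟨Y, sY, rfl, hY⟩ := S.exists_isEigenfield he hw
        exact val_leviCivita_ξ_direction he hY.self_of_nhds hX sY sX
    rw [map_sub, hφ, S.leviCivita_ξ_eq, map_sub, φ_symmPart he hv, hv, map_smul, hv]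
    module
  · intro t
    rw [map_smul, map_smul, S.symmPart_ξ, S.h_apply (mdifferentiableAt_of_smooth (S.contMDiffAt_ξ x)),
      lieDerivφ_of_isEigenfield (S.contMDiffAt_ξ x) S.isEigenfield_ξ,
      S.g.mlieBracket_eq (S.contMDiffAt_ξ x) (S.contMDiffAt_ξ x)]
    simp

theorem symmPart_φ (v : TangentSpace 𝓘(ℝ, E) x) :
    S.symmPart x (S.φ x v) = -S.φ x (S.symmPart x v) := by
  refine S.induction_decomp
    (P := fun v ↦ S.symmPart x (S.φ x v) = -S.φ x (S.symmPart x v)) ?_ ?_ ?_ v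
  · intro v w hv hw
    simp only [map_add, hv, hw, neg_add]
  · intro e v he hv
    rw [φ_symmPart he hv, hv, map_smul]
    module
  · intro t
    simp [S.φ_ξ, S.symmPart_ξ]

theorem val_h_comm (v w : TangentSpace 𝓘(ℝ, E) x) :
    S.g.val x (S.h x v) w = S.g.val x (S.h x w) v := by
  rw [h_eq, h_eq, S.val_φ_left, S.val_symmPart_comm, symmPart_φ]
  simp

theorem h_h (hR : S.g.HasConstantCurvatureTensor (-1)) (v : TangentSpace 𝓘(ℝ, E) x) :
    S.h x (S.h x v) = 0 := by
  have hB : S.symmPart x (S.symmPart x v) = 0 := by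
    refine S.induction_decomp (P := fun v ↦ S.symmPart x (S.symmPart x v) = 0) ?_ ?_ ?_ v
    · intro v w hv hw
      rw [map_add, map_add, hv, hw, add_zero]
    · intro e v he hv
      rw [symmPart_symmPart hR he hv]
      simp
    · intro t
      simp [S.symmPart_ξ]
  rw [h_eq, h_eq, symmPart_φ, hB]
  simp

theorem exists_nondegenerate_plane (hn : 1 ≤ n) (x : M) :
    ∃ v w : TangentSpace 𝓘(ℝ, E) x,
      S.g.val x v v * S.g.val x w w - S.g.val x v w ^ 2 ≠ 0 := by
  have hpos : 0 < Module.finrank ℝ (Module.End.eigenspace (S.φ x).toLinearMap 1 ⊓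
      LinearMap.ker (S.η x).toLinearMap : Submodule ℝ (TangentSpace 𝓘(ℝ, E) x)) := by
    rw [S.finrank_pos x]; omega
  have := Module.finrank_pos_iff.1 hpos
  obtain ⟨⟨v, hv⟩, hv0⟩ := exists_ne (0 : (Module.End.eigenspace (S.φ x).toLinearMap 1 ⊓
      LinearMap.ker (S.η x).toLinearMap : Submodule ℝ (TangentSpace 𝓘(ℝ, E) x)))
  have hφ := S.φ_eq_of_mem_eigenspace hv
  by_contra! hcon
  refine hv0 (Subtype.ext (S.g.nondegenerate x v fun w ↦ ?_))
  have := hcon v w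
  rw [S.val_eq_zero_of_same_sign (by norm_num) hφ hφ] at this
  simpa using this

/-- The rank of `g((∇ξ + φ) ·, ·)` on an eigenspace of `φ` of dimension at least two contradicts
its nondegeneracy, unless `c = -1`. -/
theorem eq_neg_one (hn : 2 ≤ n) (hR : S.g.HasConstantCurvatureTensor c) (x : M) : c = -1 := by
  by_contra hc
  have hc' : -(1 + c) ≠ 0 := fun h ↦ hc (by linarith)
  have h1 : (1 : ℝ) ^ 2 = 1 := by norm_num
  let D := (Module.End.eigenspace (S.φ x).toLinearMap 1 ⊓ LinearMap.ker (S.η x).toLinearMap :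
      Submodule ℝ (TangentSpace 𝓘(ℝ, E) x))
  have hD (v : D) : S.φ x v.1 = (1 : ℝ) • v.1 := S.φ_eq_of_mem_eigenspace v.2
  have hnd (v : D) (h : ∀ w : TangentSpace 𝓘(ℝ, E) x, S.φ x w = (1 : ℝ) • w →
      S.g.val x (S.symmPart x v.1) w = 0) : v = 0 := by
    have hB : S.symmPart x v.1 = 0 := by
      refine S.eq_zero_of_val (S.η_symmPart x _) fun f w hf hw ↦ ?_
      rcases (sq_eq_sq_iff_eq_or_eq_neg.1 (hf.trans h1.symm)) with rfl | rfl
      · exact h w hw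
      · exact S.val_eq_zero_of_same_sign hf (φ_symmPart h1 (hD v)) hw
    have hBB := symmPart_symmPart hR h1 (hD v)
    rw [hB, map_zero] at hBB
    exact Subtype.ext ((smul_eq_zero.1 hBB.symm).resolve_left hc')
  have hrank : 1 < Module.finrank ℝ D := by
    rw [S.finrank_pos x]; omega
  obtain ⟨u, hu⟩ : ∃ u : D, u ≠ 0 := by
    have := Module.finrank_pos_iff.1 (zero_lt_one.trans hrank)
    exact exists_ne 0
  -- the linear form `v ↦ g(B v, w)` with `g(B u, w) ≠ 0` has a kernel of positive dimension
  obtain ⟨w, hw, huw⟩ : ∃ w : TangentSpace 𝓘(ℝ, E) x, S.φ x w = (1 : ℝ) • w ∧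
      S.g.val x (S.symmPart x u.1) w ≠ 0 := by
    by_contra! hcon
    exact hu (hnd u hcon)
  let l : D →ₗ[ℝ] ℝ :=
    { toFun := fun v ↦ S.g.val x (S.symmPart x v.1) w
      map_add' := by simp
      map_smul' := by simp }
  obtain ⟨v, hv, hlv⟩ : ∃ v : D, v ≠ 0 ∧ l v = 0 := by
    by_contra! hcon
    have hinj : Function.Injective l := (injective_iff_map_eq_zero l).2 fun a ha ↦ by
      by_contra h0
      exact hcon a h0 ha
    have := LinearMap.finrank_le_finrank_of_injective hinj
    rw [Module.finrank_self] at this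
    omega
  refine hv (hnd v fun z hz ↦ ?_)
  have hm := val_symmPart_mul hR hc h1 (hD u) (hD v) hw hz
  have hlv' : S.g.val x (S.symmPart x v.1) w = 0 := hlv
  rw [hlv', zero_mul, mul_eq_zero] at hm
  exact hm.resolve_left huw

end ParacontactMetricStructure
end Paracontact

end

theorem theoremt9 (n : ℕ) (hn : 5 ≤ 2 * n + 1) (E : Type*) [NormedAddCommGroup E]
    [NormedSpace ℝ E] [FiniteDimensional ℝ E]
    (M : Type*) [TopologicalSpace M] [Nonempty M] [ChartedSpace E M] [IsManifold 𝓘(ℝ, E) ∞ M]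
    (S : Paracontact.ParacontactMetricStructure E M n) (c : ℝ)
    (hc : S.g.HasConstantSectionalCurvature c) :
    c = -1 ∧ ∀ (x : M) (ι : Type) [Fintype ι] [DecidableEq ι]
      (b : Module.Basis ι ℝ (TangentSpace 𝓘(ℝ, E) x)), S.g.normSq x b (S.h x) = 0 := by
  have hR : S.g.HasConstantCurvatureTensor c := fun x X Y Z hX hY hZ ↦
    hc.curvature_eq (S.exists_nondegenerate_plane (by omega) x) hX hY hZ
  have hc1 : c = -1 := S.eq_neg_one (by omega) hR (Classical.arbitrary M)
  subst hc1
  exact ⟨rfl, fun x ι _ _ b ↦ S.g.normSq_eq_zero x b (S.h x)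
    (Paracontact.ParacontactMetricStructure.val_h_comm)
    (Paracontact.ParacontactMetricStructure.h_h hR)⟩
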